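/- Let $a_0$ be a holomorphic function near $0\in\mathbb C$, and consider, for complex variables $(t,x)\in\mathbb C^2$, the ramified Cauchy problem $$u_t-u\,u_x=0,\qquad u(0,x)=a_0(x)+x^{1/3}.\tag{1}$$ There are a connected open neighbourhood $U$ of $(0,0)\in\mathbb C^2$ and holomorphic functions $a,p,q:U\to\mathbb C$ with $$a(0,x)=a_0(x),\qquad p(0,x)=0,\qquad q(0,x)=x\qquad\text{whenever }(0,x)\in U,\tag{2}$$ such that, with $S=\{y\in U:\ 4p(y)^3-27q(y)^2=0\}$, the following hold. 1. If $y\in U$ and $z$ is a holomorphic germ at $y$ with $z^3=pz+q$, then $u=a+z$ satisfies $u_t-u\,u_x=0$ near $y$. 2. Let $(0,x_0)\in U$, $x_0\neq0$, and let $\omega$ be a holomorphic germ at $x_0$ with $\omega(x)^3=x$ (a branch of $x^{1/3}$). There is a holomorphic germ $z$ at $(0,x_0)$ with $z^3=pz+q$ such that $u=a+z$ satisfies $u_t-u\,u_x=0$ near $(0,x_0)$ and $u(0,x)=a_0(x)+\omega(x)$ near $x_0$; and $u$ is the only holomorphic germ at $(0,x_0)$ with the last two properties. This $u$ is ramified around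 $S$: it can be continued holomorphically along every path in $U\setminus S$ starting at $(0,x_0)$, and for every $y\in S$ and every neighbourhood $W$ of $y$ there are a path in $U\setminus S$ from $(0,x_0)$ to a point $w\in W$ and a loop at $w$ in $W\cap(U\setminus S)$ such that the germ at $w$ obtained from $u$ along the path is changed by continuation along the loop. Every germ obtained from $u$ by continuation along a path in $U\setminus S$ again satisfies $u_t-u\,u_x=0$ and is of the form $a+\tilde z$ with $\tilde z^3=p\tilde z+q$. 3. $p(0,0)=q(0,0)=0$ and the differentials $dp(0,0)$, $dq(0,0)$ are linearly independent, so $S$ is, near the origin, a cusp with edge $(0,0)$. It is characteristic for the equation: if $y\in S$ and $\zeta\in\mathbb C$ is the multiple root of $\zeta^3=p(y)\zeta+q(y)$, then $D=4p^3-27q^2$ satisfies $D_t(y)-(a(y)+\zeta)D_x(y)=0$. 4. The germs of $a,p,q$ at $(0,0)$ are unique: let $a',p',q'$ be holomorphic on a connected open neighbourhood $U'$ of $(0,0)$ and satisfy $a'(0,x)=a_0(x)$, $p'(0,x)=0$, $q'(0,x)=x$ for $x$ near $0$. If for some $y\in U'$ there is a holomorphic germ $z'$ at $y$ with $z'^3=p'z'+q'$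 such that $a'+z'$ satisfies $u_t-u\,u_x=0$ near $y$, then $a'=a$, $p'=p$, $q'=q$ near $(0,0)$. -/

import Mathlib

open Filter Topology

namespace RamifiedBurgers

/-! Points of `ℂ × ℂ` are pairs `(t, x)`. Germs at a point are represented by functions
on `ℂ × ℂ`, considered up to equality on a neighbourhood of the point. -/

/-- The complex partial derivative with respect to `t`. -/
noncomputable def timeDeriv (u : ℂ × ℂ → ℂ) (y : ℂ × ℂ) : ℂ := fderiv ℂ u y (1, 0)

/-- The complex partial derivative with respect to `x`. -/
noncomputable def spaceDeriv (u : ℂ × ℂ → ℂ) (y : ℂ × ℂ) : ℂ := fderiv ℂ u y (0, 1)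

/-- `u` is a holomorphic germ at `y` with `u_t - u u_x = 0` near `y`. -/
def SolvesBurgersNear (u : ℂ × ℂ → ℂ) (y : ℂ × ℂ) : Prop :=
  AnalyticAt ℂ u y ∧ ∀ᶠ w in 𝓝 y, timeDeriv u w - u w * spaceDeriv u w = 0

/-- `ω` is a holomorphic germ at `x₀` of a branch of `x ^ (1/3)`. -/
def IsCubeRootGerm (ω : ℂ → ℂ) (x₀ : ℂ) : Prop :=
  AnalyticAt ℂ ω x₀ ∧ ∀ᶠ x in 𝓝 x₀, ω x ^ 3 = x

/-- The germ `u` at `(0, x₀)` solves `u_t - u u_x = 0`, `u(0,x) = a₀(x) + x ^ (1/3)`, where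
`x ^ (1/3)` stands for the branch `ω` near `x₀`. -/
def SolvesIVP (a₀ ω : ℂ → ℂ) (x₀ : ℂ) (u : ℂ × ℂ → ℂ) : Prop :=
  SolvesBurgersNear u (0, x₀) ∧ ∀ᶠ x in 𝓝 x₀, u (0, x) = a₀ x + ω x

/-- `z` is a holomorphic germ at `y` with `z ^ 3 = p z + q` near `y`. -/
def IsCubicRootNear (p q z : ℂ × ℂ → ℂ) (y : ℂ × ℂ) : Prop :=
  AnalyticAt ℂ z y ∧ ∀ᶠ w in 𝓝 y, z w ^ 3 = p w * z w + q w

/-- `U` is a connected open neighbourhood of the origin on which `a`, `p`, `q` are holomorphic. -/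
structure HolomorphicNearOrigin (U : Set (ℂ × ℂ)) (a p q : ℂ × ℂ → ℂ) : Prop where
  isOpen : IsOpen U
  isPreconnected : IsPreconnected U
  zero_mem : (0, 0) ∈ U
  analytic_a : AnalyticOnNhd ℂ a U
  analytic_p : AnalyticOnNhd ℂ p U
  analytic_q : AnalyticOnNhd ℂ q U

/-- The function `4 p ^ 3 - 27 q ^ 2`. -/
def discr (p q : ℂ × ℂ → ℂ) (y : ℂ × ℂ) : ℂ := 4 * p y ^ 3 - 27 * q y ^ 2

/-- The locus `4 p ^ 3 - 27 q ^ 2 = 0` in `U`. -/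
def cusp (U : Set (ℂ × ℂ)) (p q : ℂ × ℂ → ℂ) : Set (ℂ × ℂ) := {y ∈ U | discr p q y = 0}

/-- The family of germs `f s` at `γ s` is an analytic continuation along the path `γ`. -/
def IsContinuationAlong {y₀ y₁ : ℂ × ℂ} (γ : Path y₀ y₁)
    (f : unitInterval → ℂ × ℂ → ℂ) : Prop :=
  (∀ s, AnalyticAt ℂ (f s) (γ s)) ∧ ∀ s, ∀ᶠ r in 𝓝 s, f r =ᶠ[𝓝 (γ r)] f s

/-- The germ `v` at `y₀` is ramified in `U` around `S`: it can be continued along every path in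
`U \ S`, and near every point of `S` some continuation of it has nontrivial monodromy, along
arbitrarily small loops. -/
def IsRamifiedAround (U S : Set (ℂ × ℂ)) (y₀ : ℂ × ℂ) (v : ℂ × ℂ → ℂ) : Prop :=
  (∀ (y₁ : ℂ × ℂ) (γ : Path y₀ y₁), (∀ s, γ s ∈ U \ S) →
    ∃ f, IsContinuationAlong γ f ∧ f 0 =ᶠ[𝓝 y₀] v) ∧
  (∀ y ∈ S, ∀ W ∈ 𝓝 y, ∃ (w : ℂ × ℂ) (γ : Path y₀ w) (δ : Path w w)
    (f g : unitInterval → ℂ × ℂ → ℂ),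
    (∀ s, γ s ∈ U \ S) ∧ (∀ s, δ s ∈ W ∩ (U \ S)) ∧
    IsContinuationAlong γ f ∧ f 0 =ᶠ[𝓝 y₀] v ∧
    IsContinuationAlong δ g ∧ g 0 =ᶠ[𝓝 w] f 1 ∧ ¬ g 1 =ᶠ[𝓝 w] g 0)

/-- The locus `4 p ^ 3 - 27 q ^ 2 = 0` is characteristic for the linearisation
`∂_t - u ∂_x` (up to order zero) of the equation at `u = a + ζ`, where `ζ` is the
multiple root of `ζ ^ 3 = p ζ + q` over a point of this locus. -/
def CuspIsCharacteristic (U : Set (ℂ × ℂ)) (a p q : ℂ × ℂ → ℂ) : Prop :=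
  ∀ y ∈ cusp U p q, ∀ ζ : ℂ, ζ ^ 3 = p y * ζ + q y → 3 * ζ ^ 2 = p y →
    timeDeriv (discr p q) y - (a y + ζ) * spaceDeriv (discr p q) y = 0

end RamifiedBurgers

/-!
A solution is constant along its characteristics, so it satisfies the implicit equation
`(u - a₀ (x + t u)) ^ 3 = x + t u`. Write `u = a + z` with `z ^ 3 = p z + q` and replace `z` by the
companion matrix of this cubic: comparing the coefficients of `1`, `z`, `z ^ 2` turns the implicit
equation into three scalar holomorphic equations for `(a, p, q)`, which the implicit function
theorem solves. The cubic being irreducible over holomorphic germs, one branch `a + z` solves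
`u_t = u u_x` exactly when a first-order system for `(a, p, q)` holds; this system does not involve
the branch, and it determines `(a, p, q)` from the data on `t = 0`. By the system `p_t ≠ 0` at the
origin, so `(p, q)` is a chart there and the ramification is that of the roots of the universal
cubic: near a point of the cusp two roots merge, and a small half circle of their difference
swaps them.
-/

namespace RamifiedBurgers

/-! ### Analytic functions of several variables -/

section Inverse

variable {𝕜 : Type*} [NontriviallyNormedField 𝕜]
  {E F : Type*} [NormedAddCommGroup E] [NormedSpace 𝕜 E] [NormedAddCommGroup F] [NormedSpace 𝕜 F]

theorem fderiv_apply_inr {G : Type*} [NormedAddCommGroup G] [NormedSpace 𝕜 G] {f : E × F → G}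
    {x₀ : E} {y₀ v : F} {w : G} (hf : DifferentiableAt 𝕜 f (x₀, y₀))
    (h : HasDerivAt (fun s : 𝕜 => f (x₀, y₀ + s • v)) w 0) :
    fderiv 𝕜 f (x₀, y₀) (0, v) = w := by
  have hl : HasDerivAt (fun s : 𝕜 => ((x₀, y₀ + s • v) : E × F)) (0, v) 0 := by
    have := ((hasDerivAt_id (0 : 𝕜)).smul_const v).const_add y₀
    simpa using (hasDerivAt_const (0 : 𝕜) x₀).prodMk this
  have hf' : HasFDerivAt f (fderiv 𝕜 f (x₀, y₀))
      ((fun s : 𝕜 => ((x₀, y₀ + s • v) : E × F)) 0) := by simpa using hf.hasFDerivAt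
  exact (hf'.comp_hasDerivAt (0 : 𝕜) hl).unique h

theorem isInvertible_of_ker_eq_zero [CompleteSpace 𝕜] [FiniteDimensional 𝕜 F] (f : F →L[𝕜] F)
    (h : ∀ v, f v = 0 → v = 0) : f.IsInvertible := by
  have hi : Function.Injective (f : F →ₗ[𝕜] F) := (injective_iff_map_eq_zero _).2 h
  exact ⟨(LinearEquiv.ofInjectiveEndo _ hi).toContinuousLinearEquiv, by ext v; rfl⟩

end Inverse

section InverseFunction

variable {𝕜 : Type*} [RCLike 𝕜]
  {F : Type*} [NormedAddCommGroup F] [NormedSpace 𝕜 F] [FiniteDimensional 𝕜 F]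

theorem exists_analyticAt_implicit {E : Type*} [NormedAddCommGroup E] [NormedSpace 𝕜 E]
    [CompleteSpace E] {f : E × F → F} {x₀ : E} {y₀ : F}
    (hf : AnalyticAt 𝕜 f (x₀, y₀)) (hker : ∀ v, fderiv 𝕜 f (x₀, y₀) (0, v) = 0 → v = 0) :
    ∃ g : E → F, AnalyticAt 𝕜 g x₀ ∧ g x₀ = y₀ ∧
      (∀ᶠ x in 𝓝 x₀, f (x, g x) = f (x₀, y₀)) ∧
      ∀ᶠ v in 𝓝 (x₀, y₀), f v = f (x₀, y₀) → v.2 = g v.1 := by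
  have : CompleteSpace F := FiniteDimensional.complete 𝕜 F
  have hc : ContDiffAt 𝕜 ⊤ f (x₀, y₀) := hf.contDiffAt
  have hi : (fderiv 𝕜 f (x₀, y₀) ∘L .inr 𝕜 E F).IsInvertible :=
    isInvertible_of_ker_eq_zero _ fun v hv => hker v (by simpa using hv)
  have hn : (⊤ : WithTop ℕ∞) ≠ 0 := by simp
  refine ⟨hc.implicitFunction hn hi, (hc.contDiffAt_implicitFunction hn hi).analyticAt,
    hc.implicitFunction_apply_self hn hi, hc.eventually_apply_implicitFunction hn hi, ?_⟩
  filter_upwards [hc.eventually_apply_eq_iff_implicitFunction hn hi] with v hv h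
  exact (hv.1 h).symm

theorem exists_openPartialHomeomorph_target_eq_ball {f : F → F} {y : F} {P : F → Prop}
    (hf : AnalyticAt 𝕜 f y) (hker : ∀ v, fderiv 𝕜 f y v = 0 → v = 0) (hP : ∀ᶠ w in 𝓝 y, P w) :
    ∃ (φ : OpenPartialHomeomorph F F) (ρ : ℝ), 0 < ρ ∧ (φ : F → F) = f ∧ y ∈ φ.source ∧
      φ.target = Metric.ball (f y) ρ ∧ ∀ w ∈ φ.source, P w := by
  have : CompleteSpace F := FiniteDimensional.complete 𝕜 F
  obtain ⟨e, he⟩ := isInvertible_of_ker_eq_zero (fderiv 𝕜 f y) hker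
  have hd : HasFDerivAt f (e : F →L[𝕜] F) y := he ▸ hf.differentiableAt.hasFDerivAt
  have hc : ContDiffAt 𝕜 1 f y := hf.contDiffAt
  obtain ⟨s, hsP, hs, hys⟩ := eventually_nhds_iff.1 hP
  set ψ := (hc.toOpenPartialHomeomorph f hd one_ne_zero).restrOpen s hs
  have hyψ : y ∈ ψ.source := ⟨hc.mem_toOpenPartialHomeomorph_source hd one_ne_zero, hys⟩
  obtain ⟨ρ, hρ, hball⟩ := Metric.isOpen_iff.1 ψ.open_target (f y) (ψ.map_source hyψ)
  refine ⟨(ψ.symm.restrOpen _ Metric.isOpen_ball).symm, ρ, hρ, rfl,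
    ⟨hyψ, Metric.mem_ball_self hρ⟩, Set.inter_eq_right.2 hball, fun w hw => hsP w hw.1.2⟩

end InverseFunction

section Identity

variable {E F : Type*} [NormedAddCommGroup E] [NormedSpace ℂ E]
  [NormedAddCommGroup F] [NormedSpace ℂ F]

theorem eq_zero_of_eventually_smul_eq_zero {f : E → F} {R : ℝ}
    (hf : ∀ w ∈ Metric.ball (0 : E) R, AnalyticAt ℂ f w) {w : E} (hw : w ∈ Metric.ball 0 R)
    (h : ∀ᶠ τ in 𝓝 (0 : ℂ), f (τ • w) = 0) : f w = 0 := by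
  let := NormedSpace.restrictScalars ℝ ℂ E
  set T : Set ℂ := (fun τ : ℂ => τ • w) ⁻¹' Metric.ball (0 : E) R with hT
  have hconv : Convex ℝ T :=
    (convex_ball (0 : E) R).is_linear_preimage
      ⟨fun a b => add_smul a b w, fun c a => smul_assoc c a w⟩
  have han : AnalyticOnNhd ℂ (fun τ : ℂ => f (τ • w)) T := fun τ hτ =>
    (hf _ hτ).comp_of_eq (analyticAt_id.smul analyticAt_const) rfl
  have hR : 0 < R := Metric.nonempty_ball.1 ⟨w, hw⟩
  have := han.eqOn_zero_of_preconnected_of_eventuallyEq_zero hconv.isPreconnected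
    (z₀ := 0) (by simp [hT, hR]) h
  simpa using this (x := 1) (by simpa [hT] using hw)

variable [CompleteSpace F]

theorem eventually_eventuallyEq_zero_iff {f : E → F} {y : E} (hf : AnalyticAt ℂ f y) :
    ∀ᶠ w in 𝓝 y, f =ᶠ[𝓝 w] 0 ↔ f =ᶠ[𝓝 y] 0 := by
  obtain ⟨r, hr, han⟩ := Metric.eventually_nhds_iff_ball.1 hf.eventually_analyticAt
  have hconn : IsPreconnected (Metric.ball y r) := by
    let := NormedSpace.restrictScalars ℝ ℂ E
    exact (convex_ball y r).isPreconnected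
  have propagate {v w : E} (hv : v ∈ Metric.ball y r) (hw : w ∈ Metric.ball y r)
      (h : f =ᶠ[𝓝 v] 0) : f =ᶠ[𝓝 w] 0 :=
    (AnalyticOnNhd.eqOn_zero_of_preconnected_of_eventuallyEq_zero (fun x hx => han x hx) hconn hv
      h).eventuallyEq_of_mem (Metric.isOpen_ball.mem_nhds hw)
  filter_upwards [Metric.ball_mem_nhds y hr] with w hw
  exact ⟨propagate hw (Metric.mem_ball_self hr), propagate (Metric.mem_ball_self hr) hw⟩

theorem eventuallyEq_zero_of_eventually_lines {f : E → F} (hf : AnalyticAt ℂ f 0) {v₀ : E}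
    (h : ∀ᶠ v in 𝓝 v₀, ∀ᶠ τ in 𝓝 (0 : ℂ), f (τ • v) = 0) : f =ᶠ[𝓝 0] 0 := by
  obtain ⟨R, hR, han⟩ := Metric.eventually_nhds_iff_ball.1
    (hf.eventually_analyticAt.and (eventually_eventuallyEq_zero_iff hf))
  have hball : ∀ᶠ τ in 𝓝[≠] (0 : ℂ), τ • v₀ ∈ Metric.ball (0 : E) R := by
    have : ContinuousAt (fun τ : ℂ => τ • v₀) 0 := by fun_prop
    exact this.continuousWithinAt.eventually_mem (by simpa using Metric.ball_mem_nhds 0 hR)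
  obtain ⟨τ₀, hτ₀, hne : τ₀ ≠ 0⟩ := (hball.and self_mem_nhdsWithin).exists
  refine (han _ hτ₀).2.1 ?_
  have hscale : Tendsto (fun w : E => τ₀⁻¹ • w) (𝓝 (τ₀ • v₀)) (𝓝 v₀) :=
    (continuous_const_smul τ₀⁻¹).tendsto' _ _ (by simp [hne])
  filter_upwards [hscale.eventually h, Metric.isOpen_ball.mem_nhds hτ₀] with w hw hwR
  have hτ : Tendsto (fun τ : ℂ => τ * τ₀) (𝓝 0) (𝓝 0) :=
    (continuous_mul_const τ₀).tendsto' _ _ (zero_mul τ₀)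
  refine eq_zero_of_eventually_smul_eq_zero (fun v hv => (han v hv).1) hwR ?_
  filter_upwards [hτ.eventually hw] with τ h
  simpa [smul_smul, hne] using h

end Identity

attribute [local fun_prop] analyticAt_fst analyticAt_snd

/-! ### Roots of a cubic -/

theorem norm_cubic_root_le {K : Type*} [NormedDivisionRing K] {p q z : K}
    (h : z ^ 3 = p * z + q) : ‖z‖ ≤ ‖p‖ + ‖q‖ + 1 := by
  by_contra! hz
  have hnorm : ‖z‖ ^ 3 ≤ ‖p‖ * ‖z‖ + ‖q‖ := by
    rw [← norm_pow, h, ← norm_mul]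
    exact norm_add_le _ _
  have hz1 : 1 < ‖z‖ := by linarith [norm_nonneg p, norm_nonneg q]
  nlinarith [norm_nonneg q, mul_lt_mul_of_pos_right hz (one_pos.trans hz1)]

theorem three_mul_sq_ne_of_discr_ne_zero {R : Type*} [CommRing R] {P Q ζ : R}
    (h : ζ ^ 3 = P * ζ + Q) (hD : 4 * P ^ 3 - 27 * Q ^ 2 ≠ 0) : 3 * ζ ^ 2 ≠ P := by
  rintro rfl
  have hQ : Q = -2 * ζ ^ 3 := by linear_combination -h
  exact hD (by rw [hQ]; ring)

section CubicRoot

variable {p q z : ℂ × ℂ → ℂ} {y : ℂ × ℂ}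

theorem exists_isCubicRootNear {ζ : ℂ} (hp : AnalyticAt ℂ p y) (hq : AnalyticAt ℂ q y)
    (hζ : ζ ^ 3 = p y * ζ + q y) (hs : 3 * ζ ^ 2 ≠ p y) :
    ∃ z, IsCubicRootNear p q z y ∧ z y = ζ ∧
      ∀ᶠ v in 𝓝 (y, ζ), v.2 ^ 3 = p v.1 * v.2 + q v.1 → v.2 = z v.1 := by
  set f : (ℂ × ℂ) × ℂ → ℂ := fun v => v.2 ^ 3 - (p v.1 * v.2 + q v.1) with hf_def
  have hf : AnalyticAt ℂ f (y, ζ) := by unfold f; fun_prop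
  have h0 : f (y, ζ) = 0 := by simp [hf_def, hζ]
  have hker : ∀ v, fderiv ℂ f (y, ζ) (0, v) = 0 → v = 0 := fun v hv => by
    have hd : HasDerivAt (fun s : ℂ => f (y, ζ + s • v)) ((3 * ζ ^ 2 - p y) * v) 0 := by
      have hl : HasDerivAt (fun s : ℂ => ζ + s * v) v 0 := by
        simpa using ((hasDerivAt_id (0 : ℂ)).mul_const v).const_add ζ
      refine ((hl.pow 3).sub ((hl.const_mul (p y)).add_const (q y))).congr_deriv ?_
      push_cast
      ring
    rw [fderiv_apply_inr hf.differentiableAt hd] at hv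
    exact (mul_eq_zero.1 hv).resolve_left (sub_ne_zero.2 hs)
  obtain ⟨z, hz, hzy, hroot, huniq⟩ := exists_analyticAt_implicit hf hker
  rw [h0] at hroot huniq
  exact ⟨z, ⟨hz, hroot.mono fun _ => sub_eq_zero.1⟩, hzy,
    huniq.mono fun _ hv h => hv (sub_eq_zero.2 h)⟩

theorem IsCubicRootNear.self (h : IsCubicRootNear p q z y) : z y ^ 3 = p y * z y + q y :=
  h.2.self_of_nhds

theorem IsCubicRootNear.eventually (h : IsCubicRootNear p q z y) :
    ∀ᶠ w in 𝓝 y, IsCubicRootNear p q z w :=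
  h.1.eventually_analyticAt.and (eventually_eventually_nhds.2 h.2)

theorem IsCubicRootNear.eventuallyEq {z₁ z₂ : ℂ × ℂ → ℂ} (hp : AnalyticAt ℂ p y)
    (hq : AnalyticAt ℂ q y) (h₁ : IsCubicRootNear p q z₁ y) (h₂ : IsCubicRootNear p q z₂ y)
    (h : z₁ y = z₂ y) (hs : 3 * z₁ y ^ 2 ≠ p y) : z₁ =ᶠ[𝓝 y] z₂ := by
  obtain ⟨z, -, -, hu⟩ := exists_isCubicRootNear hp hq h₁.self hs
  have t₁ : Tendsto (fun w => (w, z₁ w)) (𝓝 y) (𝓝 (y, z₁ y)) :=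
    tendsto_id.prodMk_nhds h₁.1.continuousAt
  have t₂ : Tendsto (fun w => (w, z₂ w)) (𝓝 y) (𝓝 (y, z₁ y)) :=
    h ▸ tendsto_id.prodMk_nhds h₂.1.continuousAt
  filter_upwards [t₁.eventually hu, t₂.eventually hu, h₁.2, h₂.2] with w u₁ u₂ r₁ r₂
  exact (u₁ r₁).trans (u₂ r₂).symm

theorem IsCubicRootNear.fderiv_apply (hp : AnalyticAt ℂ p y) (hq : AnalyticAt ℂ q y)
    (hz : IsCubicRootNear p q z y) (v : ℂ × ℂ) :
    (3 * z y ^ 2 - p y) * fderiv ℂ z y v = fderiv ℂ p y v * z y + fderiv ℂ q y v := by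
  have hcube := hz.1.differentiableAt.hasFDerivAt.pow 3
  have hlin := (hp.differentiableAt.hasFDerivAt.mul hz.1.differentiableAt.hasFDerivAt).add
    hq.differentiableAt.hasFDerivAt
  have := congrArg (fun L => L v)
    (hlin.unique (hcube.congr_of_eventuallyEq (hz.2.mono fun w hw => hw.symm)))
  simp only [add_apply, smul_apply, smul_eq_mul, Nat.add_one_sub_one, nsmul_eq_mul,
    Nat.cast_ofNat] at this
  linear_combination -this

end CubicRoot

/-! ### The first-order system for the coefficients -/

/-- The functions `a`, `p`, `q`, which determine the family of germs `a + z`, `z ^ 3 = p z + q`,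
are holomorphic at `y`. -/
structure HolomorphicTripleAt (a p q : ℂ × ℂ → ℂ) (y : ℂ × ℂ) : Prop where
  analytic_a : AnalyticAt ℂ a y
  analytic_p : AnalyticAt ℂ p y
  analytic_q : AnalyticAt ℂ q y

/-- The coefficient of `1` when `(3 z ^ 2 - p) (u_t - u u_x)`, for `u = a + z`, is reduced to a
quadratic polynomial in `z` by means of `z ^ 3 = p z + q`. -/
noncomputable def coeffZero (a p q : ℂ × ℂ → ℂ) (w : ℂ × ℂ) : ℂ :=
  timeDeriv q w - a w * spaceDeriv q w - 3 * q w * spaceDeriv a w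
    - p w * (timeDeriv a w - a w * spaceDeriv a w)

/-- The coefficient of `z` in the same reduction as in `coeffZero`. -/
noncomputable def coeffOne (a p q : ℂ × ℂ → ℂ) (w : ℂ × ℂ) : ℂ :=
  timeDeriv p w - a w * spaceDeriv p w - 2 * p w * spaceDeriv a w - spaceDeriv q w

/-- The coefficient of `z ^ 2` in the same reduction as in `coeffZero`. -/
noncomputable def coeffTwo (a p : ℂ × ℂ → ℂ) (w : ℂ × ℂ) : ℂ :=
  3 * (timeDeriv a w - a w * spaceDeriv a w) - spaceDeriv p w

/-- The first-order system for `a`, `p`, `q` which expresses that all three branches of `a + z`,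
`z ^ 3 = p z + q`, solve `u_t - u u_x = 0`. -/
def CoeffSystemAt (a p q : ℂ × ℂ → ℂ) (w : ℂ × ℂ) : Prop :=
  coeffZero a p q w = 0 ∧ coeffOne a p q w = 0 ∧ coeffTwo a p w = 0

@[fun_prop]
theorem analyticAt_timeDeriv {f : ℂ × ℂ → ℂ} {y : ℂ × ℂ} (hf : AnalyticAt ℂ f y) :
    AnalyticAt ℂ (timeDeriv f) y :=
  ((ContinuousLinearMap.apply ℂ ℂ ((1, 0) : ℂ × ℂ)).analyticAt _).comp hf.fderiv

@[fun_prop]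
theorem analyticAt_spaceDeriv {f : ℂ × ℂ → ℂ} {y : ℂ × ℂ} (hf : AnalyticAt ℂ f y) :
    AnalyticAt ℂ (spaceDeriv f) y :=
  ((ContinuousLinearMap.apply ℂ ℂ ((0, 1) : ℂ × ℂ)).analyticAt _).comp hf.fderiv

section CoeffSystem

variable {a p q : ℂ × ℂ → ℂ} {y : ℂ × ℂ}

theorem HolomorphicNearOrigin.holomorphicTripleAt {U : Set (ℂ × ℂ)}
    (h : HolomorphicNearOrigin U a p q) (hy : y ∈ U) : HolomorphicTripleAt a p q y :=
  ⟨h.analytic_a y hy, h.analytic_p y hy, h.analytic_q y hy⟩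

namespace HolomorphicTripleAt

theorem eventually (h : HolomorphicTripleAt a p q y) :
    ∀ᶠ w in 𝓝 y, HolomorphicTripleAt a p q w := by
  filter_upwards [h.1.eventually_analyticAt, h.2.eventually_analyticAt,
    h.3.eventually_analyticAt] with w ha hp hq
  exact ⟨ha, hp, hq⟩

theorem analyticAt_coeffZero (h : HolomorphicTripleAt a p q y) :
    AnalyticAt ℂ (coeffZero a p q) y := by
  obtain ⟨ha, hp, hq⟩ := h
  unfold coeffZero
  fun_prop

theorem analyticAt_coeffOne (h : HolomorphicTripleAt a p q y) :
    AnalyticAt ℂ (coeffOne a p q) y := by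
  obtain ⟨ha, hp, hq⟩ := h
  unfold coeffOne
  fun_prop

theorem analyticAt_coeffTwo (h : HolomorphicTripleAt a p q y) : AnalyticAt ℂ (coeffTwo a p) y := by
  obtain ⟨ha, hp, -⟩ := h
  unfold coeffTwo
  fun_prop

theorem burgers_add_root (h : HolomorphicTripleAt a p q y) {z : ℂ × ℂ → ℂ}
    (hz : IsCubicRootNear p q z y) :
    (3 * z y ^ 2 - p y) * (timeDeriv (fun w => a w + z w) y
        - (a y + z y) * spaceDeriv (fun w => a w + z w) y) =
      coeffZero a p q y + coeffOne a p q y * z y + coeffTwo a p y * z y ^ 2 := by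
  have hd : fderiv ℂ (fun w => a w + z w) y = fderiv ℂ a y + fderiv ℂ z y :=
    fderiv_fun_add h.1.differentiableAt hz.1.differentiableAt
  have ht := hz.fderiv_apply h.2 h.3 (1, 0)
  have hx := hz.fderiv_apply h.2 h.3 (0, 1)
  simp only [timeDeriv, spaceDeriv, coeffZero, coeffOne, coeffTwo, hd, add_apply]
  linear_combination ht - (a y + z y) * hx - 3 * fderiv ℂ a y (0, 1) * hz.self

theorem solvesBurgersNear_of_coeffSystemAt (h : HolomorphicTripleAt a p q y) {z : ℂ × ℂ → ℂ}
    (hsys : ∀ᶠ w in 𝓝 y, CoeffSystemAt a p q w) (hz : IsCubicRootNear p q z y)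
    (hs : 3 * z y ^ 2 ≠ p y) : SolvesBurgersNear (fun w => a w + z w) y := by
  refine ⟨h.1.add hz.1, ?_⟩
  have hsimple : ∀ᶠ w in 𝓝 y, 3 * z w ^ 2 - p w ≠ 0 :=
    ((hz.1.continuousAt.pow 2).const_mul 3 |>.sub h.2.continuousAt).eventually_ne
      (sub_ne_zero.2 hs)
  filter_upwards [h.eventually, hsys, hz.eventually, hsimple]
    with w hw ⟨h0, h1, h2⟩ hzw hsw
  refine (mul_eq_zero.1 ?_).resolve_left hsw
  rw [hw.burgers_add_root hzw, h0, h1, h2]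
  ring

end HolomorphicTripleAt

theorem cuspIsCharacteristic_of_coeffSystemAt {U : Set (ℂ × ℂ)} (hp : AnalyticOnNhd ℂ p U)
    (hq : AnalyticOnNhd ℂ q U) (hsys : ∀ w ∈ U, CoeffSystemAt a p q w) :
    CuspIsCharacteristic U a p q := by
  intro y hy ζ hζ hζ2
  obtain ⟨h0, h1, h2⟩ := hsys y hy.1
  have hD : ∀ v, fderiv ℂ (discr p q) y v =
      12 * p y ^ 2 * fderiv ℂ p y v - 54 * q y * fderiv ℂ q y v := by
    intro v
    have hd : HasFDerivAt (discr p q) _ y :=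
      (((hp y hy.1).differentiableAt.hasFDerivAt.pow 3).const_mul 4).sub
        (((hq y hy.1).differentiableAt.hasFDerivAt.pow 2).const_mul 27)
    rw [hd.fderiv]
    simp only [Nat.add_one_sub_one, nsmul_eq_mul, Nat.cast_ofNat, pow_one, sub_apply, smul_apply,
      smul_eq_mul]
    ring
  have hqζ : q y = -2 * ζ ^ 3 := by linear_combination -hζ + ζ * hζ2
  simp only [timeDeriv, spaceDeriv, coeffZero, coeffOne, coeffTwo, hD] at h0 h1 h2 ⊢
  rw [← hζ2, hqζ] at h0 ⊢
  rw [← hζ2] at h1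
  linear_combination 108 * ζ ^ 4 * h1 + 108 * ζ ^ 3 * (h0 + ζ ^ 2 * h2)

end CoeffSystem

/-! ### Uniqueness for the Cauchy problem: the method of characteristics -/

theorem eq_zero_of_hasDerivAt_mul {A : Type*} [NormedRing A] [NormedSpace ℝ A] {f k : ℝ → A}
    {s t : ℝ} (hk : ContinuousOn k (Set.Icc s t))
    (hf : ∀ r ∈ Set.Icc s t, HasDerivAt f (k r * f r) r) (hs : f s = 0) :
    ∀ r ∈ Set.Icc s t, f r = 0 := by
  obtain ⟨K, hK⟩ := isCompact_Icc.exists_bound_of_continuousOn hk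
  intro r hr
  have := norm_le_gronwallBound_of_norm_deriv_right_le (δ := 0) (K := K) (ε := 0)
    (fun r hr => (hf r hr).continuousAt.continuousWithinAt)
    (fun r hr => (hf r (Set.Ico_subset_Icc_self hr)).hasDerivWithinAt) (by simp [hs])
    (fun r hr => (norm_mul_le _ _).trans <| by
      rw [add_zero]
      exact mul_le_mul_of_nonneg_right (hK r (Set.Ico_subset_Icc_self hr)) (norm_nonneg _)) r hr
  rwa [gronwallBound_ε0_δ0, norm_le_zero_iff] at this

theorem SolvesBurgersNear.eventually {v : ℂ × ℂ → ℂ} {y : ℂ × ℂ} (h : SolvesBurgersNear v y) :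
    ∀ᶠ w in 𝓝 y, SolvesBurgersNear v w :=
  h.1.eventually_analyticAt.and (eventually_eventually_nhds.2 h.2)

theorem eq_of_characteristic {v : ℂ × ℂ → ℂ} {B : Set (ℂ × ℂ)} (hB : Convex ℝ B)
    (hv : ∀ w ∈ B, SolvesBurgersNear v w) {t x : ℂ} (h₀ : (0, x) ∈ B)
    (h₁ : (t, x - t * v (0, x)) ∈ B) : v (t, x - t * v (0, x)) = v (0, x) := by
  set c := v (0, x)
  set l : ℝ → ℂ × ℂ := fun r => (r * t, x - r * t * c) with hl
  have hlB : ∀ r ∈ Set.Icc (0 : ℝ) 1, l r ∈ B := by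
    intro r hr
    convert hB h₀ h₁ (sub_nonneg.2 hr.2) hr.1 (by ring) using 1
    ext <;> simp [hl]
    ring
  have hl' : ∀ r : ℝ, HasDerivAt l (t, -(t * c)) r := by
    intro r
    have hrt : HasDerivAt (fun r : ℝ => (r : ℂ) * t) t r := by
      simpa using (Complex.ofRealCLM.hasDerivAt (x := r)).mul_const t
    exact hrt.prodMk ((hrt.mul_const c).const_sub x)
  have hcont : ContinuousOn (fun r => t * spaceDeriv v (l r)) (Set.Icc 0 1) := fun r hr =>
    (((analyticAt_spaceDeriv (hv _ (hlB r hr)).1).continuousAt.comp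
      (hl' r).continuousAt).const_mul t).continuousWithinAt
  -- By the equation, `(v - c) ∘ l` satisfies a linear homogeneous differential equation.
  have hder : ∀ r ∈ Set.Icc (0 : ℝ) 1, HasDerivAt (fun r => v (l r) - c)
      (t * spaceDeriv v (l r) * (v (l r) - c)) r := by
    intro r hr
    obtain ⟨han, heq⟩ := hv _ (hlB r hr)
    refine (((han.differentiableAt.hasFDerivAt.restrictScalars ℝ).comp_hasDerivAt r
      (hl' r)).sub_const c).congr_deriv ?_
    have hdir : ((t, -(t * c)) : ℂ × ℂ) = t • ((1, 0) : ℂ × ℂ) + (-(t * c)) • ((0, 1) : ℂ × ℂ) := by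
      ext <;> simp
    have := heq.self_of_nhds
    simp only [timeDeriv, spaceDeriv] at this ⊢
    rw [ContinuousLinearMap.coe_restrictScalars', hdir, map_add, map_smul, map_smul, smul_eq_mul,
      smul_eq_mul]
    linear_combination t * this
  have := eq_zero_of_hasDerivAt_mul hcont hder (by simp [hl, c]) 1 (by simp)
  simpa [hl, sub_eq_zero] using this

theorem SolvesBurgersNear.eventually_eq_of_characteristic {v : ℂ × ℂ → ℂ} {x₀ : ℂ}
    (hv : SolvesBurgersNear v (0, x₀)) :
    ∀ᶠ c in 𝓝 ((0, x₀) : ℂ × ℂ), v (c.1, c.2 - c.1 * v (0, c.2)) = v (0, c.2) := by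
  obtain ⟨ε, hε, hball⟩ := Metric.eventually_nhds_iff_ball.1 hv.eventually
  have hv₀ : ContinuousAt (fun c : ℂ × ℂ => v (0, c.2)) (0, x₀) :=
    ContinuousAt.comp (f := fun c : ℂ × ℂ => ((0, c.2) : ℂ × ℂ)) hv.1.continuousAt (by fun_prop)
  have hend : ContinuousAt (fun c : ℂ × ℂ => (c.1, c.2 - c.1 * v (0, c.2))) (0, x₀) :=
    continuousAt_fst.prodMk (continuousAt_snd.sub (continuousAt_fst.mul hv₀))
  have hstart : ContinuousAt (fun c : ℂ × ℂ => ((0, c.2) : ℂ × ℂ)) (0, x₀) := by fun_prop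
  filter_upwards [hend.eventually_mem (by simpa using Metric.ball_mem_nhds _ hε),
    hstart.eventually_mem (Metric.ball_mem_nhds _ hε)] with c h₁ h₀
  exact eq_of_characteristic (convex_ball _ _) hball h₀ h₁

theorem exists_foot_of_characteristic {g : ℂ → ℂ} {x₀ : ℂ} (hg : AnalyticAt ℂ g x₀) :
    ∃ ξ : ℂ × ℂ → ℂ, Tendsto ξ (𝓝 (0, x₀)) (𝓝 x₀) ∧
      ∀ᶠ w in 𝓝 ((0, x₀) : ℂ × ℂ), ξ w - w.1 * g (ξ w) = w.2 := by
  set F : (ℂ × ℂ) × ℂ → ℂ := fun c => c.2 - c.1.1 * g c.2 - c.1.2 with hF_def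
  have hF : AnalyticAt ℂ F ((0, x₀), x₀) := by unfold F; fun_prop
  have hker : ∀ k, fderiv ℂ F ((0, x₀), x₀) (0, k) = 0 → k = 0 := fun k hk => by
    have hd : HasDerivAt (fun s : ℂ => F ((0, x₀), x₀ + s • k)) k 0 := by
      simpa [hF_def] using (((hasDerivAt_id (0 : ℂ)).mul_const k).const_add x₀).sub_const x₀
    rwa [fderiv_apply_inr hF.differentiableAt hd] at hk
  obtain ⟨ξ, hξ, hξ0, hξF, -⟩ := exists_analyticAt_implicit hF hker
  refine ⟨ξ, by simpa [hξ0] using hξ.continuousAt.tendsto, hξF.mono fun w hw => ?_⟩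
  rw [show F ((0, x₀), x₀) = 0 by simp [hF_def]] at hw
  exact sub_eq_zero.1 hw

theorem SolvesBurgersNear.eventuallyEq {v₁ v₂ : ℂ × ℂ → ℂ} {x₀ : ℂ}
    (h₁ : SolvesBurgersNear v₁ (0, x₀)) (h₂ : SolvesBurgersNear v₂ (0, x₀))
    (h : ∀ᶠ x in 𝓝 x₀, v₁ (0, x) = v₂ (0, x)) : v₁ =ᶠ[𝓝 (0, x₀)] v₂ := by
  have hg : AnalyticAt ℂ (fun x => v₁ (0, x)) x₀ := by
    have := h₁.1
    fun_prop
  obtain ⟨ξ, hξ, hfoot⟩ := exists_foot_of_characteristic hg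
  have ht : Tendsto (fun w : ℂ × ℂ => (w.1, ξ w)) (𝓝 (0, x₀)) (𝓝 (0, x₀)) :=
    continuousAt_fst.tendsto.prodMk_nhds hξ
  filter_upwards [ht.eventually h₁.eventually_eq_of_characteristic,
    ht.eventually h₂.eventually_eq_of_characteristic, hξ.eventually h, hfoot] with w e₁ e₂ e hw
  simp only [← e, hw] at e₁ e₂
  exact e₁.trans e₂.symm

theorem SolvesIVP.eventuallyEq {a₀ ω : ℂ → ℂ} {x₀ : ℂ} {u v : ℂ × ℂ → ℂ}
    (hu : SolvesIVP a₀ ω x₀ u) (hv : SolvesIVP a₀ ω x₀ v) : u =ᶠ[𝓝 (0, x₀)] v :=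
  hu.1.eventuallyEq hv.1 ((hu.2.and hv.2).mono fun _ h => h.1.trans h.2.symm)

/-! ### Construction of the family by functional calculus -/

section FunctionalCalculus

open FormalMultilinearSeries

section

variable {𝕜 A : Type*} [NontriviallyNormedField 𝕜] [NormedRing A] [NormedAlgebra 𝕜 A]
  [NormOneClass A]

theorem radius_le_radius_ofScalars_coeff (P : FormalMultilinearSeries 𝕜 𝕜 𝕜) :
    P.radius ≤ (ofScalars A P.coeff).radius := by
  refine ENNReal.le_of_forall_nnreal_lt fun r hr => ?_
  obtain ⟨C, -, hC⟩ := P.norm_mul_pow_le_of_lt_radius hr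
  refine le_radius_of_bound _ C fun n => ?_
  rw [ofScalars_norm, ← norm_apply_eq_norm_coef]
  exact hC n

theorem mem_eball_zero_of_norm_lt {E : Type*} [SeminormedAddCommGroup E] {x : E} {r : NNReal}
    {R : ENNReal} (hx : ‖x‖ < r) (hrR : r < R) : x ∈ Metric.eball (0 : E) R := by
  rw [Metric.mem_eball, edist_zero_right]
  refine lt_trans ?_ hrR
  rwa [← ofReal_norm, ENNReal.ofReal_lt_coe_iff (norm_nonneg _)]

theorem exists_functionalCalculus [CompleteSpace 𝕜] [CompleteSpace A] {a₀ : 𝕜 → 𝕜}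
    (ha₀ : AnalyticAt 𝕜 a₀ 0) :
    ∃ f : A → A, AnalyticAt 𝕜 f 0 ∧ ∃ r > 0, ∀ m, ‖m‖ < r → AnalyticAt 𝕜 a₀ m ∧
      ∀ X, ‖X‖ < r → ∀ {V : Type} [NormedAddCommGroup V] [NormedSpace 𝕜 V] (L : A →L[𝕜] V),
        (∀ n : ℕ, L (X ^ n) = m ^ n • L 1) → L (f X) = a₀ m • L 1 := by
  obtain ⟨P, R, hP⟩ := ha₀
  obtain ⟨r, hr0, hrR⟩ := ENNReal.lt_iff_exists_nnreal_btwn.1 hP.r_pos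
  have hRQ : R ≤ (ofScalars A P.coeff).radius :=
    hP.r_le.trans (radius_le_radius_ofScalars_coeff P)
  refine ⟨(ofScalars A P.coeff).sum,
    (FormalMultilinearSeries.hasFPowerSeriesOnBall _ (hP.r_pos.trans_le hRQ)).analyticAt, r,
    by exact_mod_cast hr0, fun m hm =>
      ⟨hP.analyticAt_of_mem (mem_eball_zero_of_norm_lt hm hrR), fun X hX V _ _ L hL => ?_⟩⟩
  have hLX := L.hasSum <| (ofScalars A P.coeff).hasSum <|
    mem_eball_zero_of_norm_lt hX (hrR.trans_le hRQ)
  have hm' := (hP.hasSum_sub (mem_eball_zero_of_norm_lt hm hrR)).smul_const (L 1)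
  refine hLX.unique (hm'.congr_fun fun n => ?_)
  rw [ofScalars_apply_eq, map_smul, hL, smul_smul, sub_zero, apply_eq_pow_smul_coeff, smul_eq_mul,
    mul_comm]

end

open scoped Matrix.Norms.Operator
open Matrix

variable {n : Type} [Fintype n] [DecidableEq n]

theorem vecMul_pow_of_vecMul_eq_smul {R : Type*} [CommSemiring R] {l : n → R} {X : Matrix n n R}
    {m : R} (h : l ᵥ* X = m • l) (k : ℕ) : l ᵥ* (X ^ k) = m ^ k • l := by
  induction k with
  | zero => simp
  | succ k ih => rw [pow_succ, ← vecMul_vecMul, ih, smul_vecMul, h, smul_smul, pow_succ]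

theorem exists_matrix_functionalCalculus [Nonempty n] {a₀ : ℂ → ℂ} (ha₀ : AnalyticAt ℂ a₀ 0) :
    ∃ f : Matrix n n ℂ → Matrix n n ℂ, AnalyticAt ℂ f 0 ∧ ∃ r > 0,
      ∀ m, ‖m‖ < r → AnalyticAt ℂ a₀ m ∧
        ∀ X, ‖X‖ < r → ∀ l, l ᵥ* X = m • l → l ᵥ* f X = a₀ m • l := by
  obtain ⟨f, hf, r, hr, hcalc⟩ := exists_functionalCalculus (A := Matrix n n ℂ) ha₀
  refine ⟨f, hf, r, hr, fun m hm => ⟨(hcalc m hm).1, fun X hX l hl => ?_⟩⟩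
  let L : Matrix n n ℂ →L[ℂ] (n → ℂ) := LinearMap.toContinuousLinearMap
    { toFun := fun Y => l ᵥ* Y
      map_add' := fun Y Z => vecMul_add Y Z l
      map_smul' := fun k Y => vecMul_smul l k Y }
  have hL : l ᵥ* f X = a₀ m • (l ᵥ* 1) := (hcalc m hm).2 X hX L fun k =>
    show l ᵥ* (X ^ k) = m ^ k • (l ᵥ* 1) by rw [vecMul_one, vecMul_pow_of_vecMul_eq_smul hl]
  rwa [vecMul_one] at hL

end FunctionalCalculus

section CompanionMatrix

open scoped Matrix.Norms.Operator
open Matrix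

/-- The companion matrix of `Z ^ 3 - p Z - q` shifted by the scalar `a`, where `c = (a, p, q)`: its
left eigenvectors are the vectors `(1, z, z ^ 2)`, with eigenvalue `a + z`, for the roots `z`. -/
def shiftedCompanion (c : ℂ × ℂ × ℂ) : Matrix (Fin 3) (Fin 3) ℂ :=
  c.1 • 1 + (!![0, 0, 0; 1, 0, 0; 0, 1, 0] + c.2.1 • !![0, 0, 0; 0, 0, 1; 0, 0, 0] +
    c.2.2 • !![0, 0, 1; 0, 0, 0; 0, 0, 0])

/-- The matrix form of the foot `x + t u` of the characteristic through `v.1 = (t, x)`, with the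
companion matrix for `v.2 = (a, p, q)` in place of `u`. -/
def footMatrix (v : (ℂ × ℂ) × (ℂ × ℂ × ℂ)) : Matrix (Fin 3) (Fin 3) ℂ :=
  v.1.2 • 1 + v.1.1 • shiftedCompanion v.2

/-- The matrix form of the characteristic equation `(u - a₀ (x + t u)) ^ 3 - (x + t u) = 0`, where
`f` stands for the functional calculus of `a₀`. -/
def implicitMatrix (f : Matrix (Fin 3) (Fin 3) ℂ → Matrix (Fin 3) (Fin 3) ℂ)
    (v : (ℂ × ℂ) × (ℂ × ℂ × ℂ)) : Matrix (Fin 3) (Fin 3) ℂ :=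
  (shiftedCompanion v.2 - f (footMatrix v)) ^ 3 - footMatrix v

/-- The first column of `implicitMatrix`: three scalar equations for the unknowns `a`, `p`, `q`. -/
def implicitColumn (f : Matrix (Fin 3) (Fin 3) ℂ → Matrix (Fin 3) (Fin 3) ℂ)
    (v : (ℂ × ℂ) × (ℂ × ℂ × ℂ)) : ℂ × ℂ × ℂ :=
  (implicitMatrix f v 0 0, implicitMatrix f v 1 0, implicitMatrix f v 2 0)

/-- The value `u` at `w = (t, x)` satisfies `(u - a₀ (x + t u)) ^ 3 = x + t u`, the equation which
expresses that `u` is constant along characteristics and equal to `a₀ + x ^ (1/3)` at time zero. -/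
def SolvesImplicit (a₀ : ℂ → ℂ) (w : ℂ × ℂ) (u : ℂ) : Prop :=
  AnalyticAt ℂ a₀ (w.2 + w.1 * u) ∧ (u - a₀ (w.2 + w.1 * u)) ^ 3 = w.2 + w.1 * u

/-- The initial conditions for `a`, `p`, `q` on the line `t = 0`, near `x₀`. -/
def HasInitialValues (a₀ : ℂ → ℂ) (a p q : ℂ × ℂ → ℂ) (x₀ : ℂ) : Prop :=
  ∀ᶠ x in 𝓝 x₀, a (0, x) = a₀ x ∧ p (0, x) = 0 ∧ q (0, x) = x

theorem vecMul_shiftedCompanion (c : ℂ × ℂ × ℂ) {z : ℂ} (hz : z ^ 3 = c.2.1 * z + c.2.2) :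
    ![1, z, z ^ 2] ᵥ* shiftedCompanion c = (c.1 + z) • ![1, z, z ^ 2] := by
  ext i
  fin_cases i <;>
    simp [shiftedCompanion, vecMul, dotProduct, Fin.sum_univ_three, Matrix.one_apply]
  · ring
  · linear_combination -hz

theorem vecMul_footMatrix (w : ℂ × ℂ) {c : ℂ × ℂ × ℂ} {z : ℂ} (hz : z ^ 3 = c.2.1 * z + c.2.2) :
    ![1, z, z ^ 2] ᵥ* footMatrix (w, c) = (w.2 + w.1 * (c.1 + z)) • ![1, z, z ^ 2] := by
  rw [footMatrix, vecMul_add, vecMul_smul, vecMul_smul, vecMul_shiftedCompanion c hz, vecMul_one,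
    smul_smul, ← add_smul]

theorem cube_eq_of_implicitColumn_eq_zero {f : Matrix (Fin 3) (Fin 3) ℂ → Matrix (Fin 3) (Fin 3) ℂ}
    {w : ℂ × ℂ} {c : ℂ × ℂ × ℂ} {z b : ℂ} (h : implicitColumn f (w, c) = 0)
    (hz : z ^ 3 = c.2.1 * z + c.2.2)
    (hf : ![1, z, z ^ 2] ᵥ* f (footMatrix (w, c)) = b • ![1, z, z ^ 2]) :
    (c.1 + z - b) ^ 3 = w.2 + w.1 * (c.1 + z) := by
  have hmul : ![1, z, z ^ 2] ᵥ* implicitMatrix f (w, c) =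
      ((c.1 + z - b) ^ 3 - (w.2 + w.1 * (c.1 + z))) • ![1, z, z ^ 2] := by
    rw [implicitMatrix, vecMul_sub, vecMul_footMatrix w hz,
      vecMul_pow_of_vecMul_eq_smul (m := c.1 + z - b), sub_smul]
    rw [vecMul_sub, vecMul_shiftedCompanion c hz, hf, sub_smul]
  have h0 := congrFun hmul 0
  simp only [implicitColumn, Prod.mk_eq_zero] at h
  simp only [vecMul, dotProduct, Fin.sum_univ_three, cons_val_zero, h, mul_zero, cons_val_one,
    add_zero, cons_val, Pi.smul_apply, smul_eq_mul, mul_one] at h0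
  exact sub_eq_zero.1 h0.symm

@[fun_prop]
theorem analyticAt_shiftedCompanion (c : ℂ × ℂ × ℂ) : AnalyticAt ℂ shiftedCompanion c := by
  unfold shiftedCompanion
  fun_prop

@[fun_prop]
theorem analyticAt_footMatrix (v : (ℂ × ℂ) × (ℂ × ℂ × ℂ)) : AnalyticAt ℂ footMatrix v := by
  unfold footMatrix
  fun_prop

theorem analyticAt_implicitColumn {f : Matrix (Fin 3) (Fin 3) ℂ → Matrix (Fin 3) (Fin 3) ℂ}
    (hf : AnalyticAt ℂ f 0) (c : ℂ × ℂ × ℂ) :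
    AnalyticAt ℂ (implicitColumn f) ((0, 0), c) := by
  have hfX : AnalyticAt ℂ (fun v => f (footMatrix v)) ((0, 0), c) :=
    hf.comp_of_eq (analyticAt_footMatrix _) (by simp [footMatrix])
  have hM : AnalyticAt ℂ (implicitMatrix f) ((0, 0), c) := by
    exact (((analyticAt_shiftedCompanion _).comp analyticAt_snd).sub hfX).pow 3 |>.sub
      (analyticAt_footMatrix _)
  have hentry (i j : Fin 3) : AnalyticAt ℂ (fun v => implicitMatrix f v i j) ((0, 0), c) :=
    ((LinearMap.toContinuousLinearMap (Matrix.entryLinearMap ℂ ℂ i j)).analyticAt _).fun_comp hM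
  exact (hentry 0 0).prod ((hentry 1 0).prod (hentry 2 0))

theorem implicitColumn_of_time_eq_zero {f : Matrix (Fin 3) (Fin 3) ℂ → Matrix (Fin 3) (Fin 3) ℂ}
    {x b : ℂ} (hf : f (x • 1) = b • 1) (c : ℂ × ℂ × ℂ) :
    implicitColumn f ((0, x), c) =
      ((c.1 - b) ^ 3 + c.2.2 - x, 3 * (c.1 - b) ^ 2 + c.2.1, 3 * (c.1 - b)) := by
  have h : implicitMatrix f ((0, x), c) = shiftedCompanion (c.1 - b, c.2) ^ 3 - x • 1 := by
    simp only [implicitMatrix, footMatrix, zero_smul, add_zero, hf]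
    congr 2
    simp only [shiftedCompanion, sub_smul]
    abel
  simp only [implicitColumn, h]
  simp [shiftedCompanion, pow_succ, Matrix.mul_apply, Fin.sum_univ_three, Matrix.one_apply]
  constructor <;> ring

theorem eq_zero_of_fderiv_implicitColumn_eq_zero
    {f : Matrix (Fin 3) (Fin 3) ℂ → Matrix (Fin 3) (Fin 3) ℂ} {b p q : ℂ} {v : ℂ × ℂ × ℂ}
    (hd : DifferentiableAt ℂ (implicitColumn f) ((0, 0), (b, p, q))) (hf : f 0 = b • 1)
    (hv : fderiv ℂ (implicitColumn f) ((0, 0), (b, p, q)) (0, v) = 0) : v = 0 := by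
  have hline : HasDerivAt (fun s : ℂ => implicitColumn f ((0, 0), (b, p, q) + s • v))
      (v.2.2, v.2.1, 3 * v.1) 0 := by
    simp only [implicitColumn_of_time_eq_zero (x := 0) (b := b) (by rwa [zero_smul])]
    have hmul (k : ℂ) : HasDerivAt (fun s : ℂ => s * k) k 0 := by
      simpa using (hasDerivAt_id (0 : ℂ)).mul_const k
    have h3 := ((hmul v.1).pow 3).add ((hmul v.2.2).const_add q)
    have h2 := (((hmul v.1).pow 2).const_mul 3).add ((hmul v.2.1).const_add p)
    have h1 := (hmul v.1).const_mul 3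
    convert h3.prodMk (h2.prodMk h1) using 1
    · ext s <;> simp
    · simp
  rw [fderiv_apply_inr hd hline] at hv
  simp only [Prod.mk_eq_zero, mul_eq_zero, OfNat.ofNat_ne_zero, false_or] at hv
  exact Prod.ext hv.2.2 (Prod.ext hv.2.1 hv.1)

theorem exists_implicitColumn_eq_zero {f : Matrix (Fin 3) (Fin 3) ℂ → Matrix (Fin 3) (Fin 3) ℂ}
    {a₀ : ℂ → ℂ} (ha₀ : ContinuousAt a₀ 0) (hf : AnalyticAt ℂ f 0)
    (hfx : ∀ᶠ x in 𝓝 (0 : ℂ), f (x • 1) = a₀ x • 1) :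
    ∃ a p q : ℂ × ℂ → ℂ, HolomorphicTripleAt a p q (0, 0) ∧ HasInitialValues a₀ a p q 0 ∧
      ∀ᶠ w in 𝓝 ((0, 0) : ℂ × ℂ), implicitColumn f (w, (a w, p w, q w)) = 0 := by
  have hf0 : f 0 = a₀ 0 • 1 := by simpa using hfx.self_of_nhds
  have hΦ := analyticAt_implicitColumn hf (a₀ 0, 0, 0)
  obtain ⟨g, hg, -, hgΦ, hgu⟩ := exists_analyticAt_implicit hΦ fun v hv =>
    eq_zero_of_fderiv_implicitColumn_eq_zero hΦ.differentiableAt hf0 hv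
  have hΦ0 : implicitColumn f ((0, 0), (a₀ 0, 0, 0)) = 0 := by
    simp [implicitColumn_of_time_eq_zero hfx.self_of_nhds]
  rw [hΦ0] at hgΦ hgu
  refine ⟨fun w => (g w).1, fun w => (g w).2.1, fun w => (g w).2.2,
    ⟨by fun_prop, by fun_prop, by fun_prop⟩, ?_, hgΦ⟩
  have ht : ContinuousAt (fun x : ℂ => (((0, x), (a₀ x, 0, x)) : (ℂ × ℂ) × (ℂ × ℂ × ℂ))) 0 := by
    fun_prop
  filter_upwards [ht.eventually hgu, hfx] with x hx hfx
  simp [← hx (by simp [implicitColumn_of_time_eq_zero hfx])]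

theorem HolomorphicTripleAt.eventually_norm_lt {a p q : ℂ × ℂ → ℂ}
    (h : HolomorphicTripleAt a p q (0, 0)) {r : ℝ} (hr : 0 < r) :
    ∀ᶠ w in 𝓝 ((0, 0) : ℂ × ℂ), ‖footMatrix (w, (a w, p w, q w))‖ < r ∧
      ∀ z : ℂ, z ^ 3 = p w * z + q w → ‖w.2 + w.1 * (a w + z)‖ < r := by
  obtain ⟨ha, hp, hq⟩ := h
  have hX : ContinuousAt (fun w => footMatrix (w, (a w, p w, q w))) ((0, 0) : ℂ × ℂ) :=
    ((analyticAt_footMatrix _).fun_comp (analyticAt_id.prod (ha.prod (hp.prod hq)))).continuousAt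
  have hm : ContinuousAt (fun w : ℂ × ℂ => ‖w.2‖ + ‖w.1‖ * (‖a w‖ + (‖p w‖ + ‖q w‖ + 1)))
      (0, 0) := by
    have := ha.continuousAt
    have := hp.continuousAt
    have := hq.continuousAt
    fun_prop
  filter_upwards [hX.norm.eventually_lt continuousAt_const (by simpa [footMatrix] using hr),
    hm.eventually_lt continuousAt_const (by simpa using hr)] with w hXw hmw
  refine ⟨hXw, fun z hz => lt_of_le_of_lt ((norm_add_le _ _).trans ?_) hmw⟩
  rw [norm_mul]
  gcongr
  exact (norm_add_le _ _).trans (by gcongr; exact norm_cubic_root_le hz)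

theorem exists_solvesImplicit {a₀ : ℂ → ℂ} (ha₀ : AnalyticAt ℂ a₀ 0) :
    ∃ a p q : ℂ × ℂ → ℂ, HolomorphicTripleAt a p q (0, 0) ∧ HasInitialValues a₀ a p q 0 ∧
      ∀ᶠ w in 𝓝 ((0, 0) : ℂ × ℂ), ∀ z : ℂ, z ^ 3 = p w * z + q w →
        SolvesImplicit a₀ w (a w + z) := by
  obtain ⟨f, hf, r, hr, hcalc⟩ := exists_matrix_functionalCalculus (n := Fin 3) ha₀
  have hfx : ∀ᶠ x in 𝓝 (0 : ℂ), f (x • 1) = a₀ x • 1 := by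
    filter_upwards [Metric.ball_mem_nhds (0 : ℂ) hr] with x hx
    rw [mem_ball_zero_iff] at hx
    refine ext_iff_vecMul.2 fun l => ?_
    simpa [vecMul_smul] using
      (hcalc x hx).2 (x • 1) (by simpa [norm_smul] using hx) l (by simp [vecMul_smul])
  obtain ⟨a, p, q, htriple, hinit, hcol⟩ := exists_implicitColumn_eq_zero ha₀.continuousAt hf hfx
  refine ⟨a, p, q, htriple, hinit, ?_⟩
  filter_upwards [hcol, htriple.eventually_norm_lt hr] with w hw ⟨hX, hm⟩ z hz
  obtain ⟨han, hvec⟩ := hcalc _ (hm z hz)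
  have heigen := hvec _ hX _ (vecMul_footMatrix w (c := (a w, p w, q w)) hz)
  have hcube := cube_eq_of_implicitColumn_eq_zero (c := (a w, p w, q w)) hw hz heigen
  exact ⟨han, hcube⟩

end CompanionMatrix

theorem burgers_of_solvesImplicit {a₀ : ℂ → ℂ} {u : ℂ × ℂ → ℂ} {y : ℂ × ℂ}
    (hu : AnalyticAt ℂ u y) (h : ∀ᶠ w in 𝓝 y, SolvesImplicit a₀ w (u w)) :
    timeDeriv u y - u y * spaceDeriv u y = 0 := by
  have hfoot := (hasFDerivAt_snd (𝕜 := ℂ) (p := y)).add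
    ((hasFDerivAt_fst (𝕜 := ℂ) (p := y)).mul hu.differentiableAt.hasFDerivAt)
  have hcube := (hu.differentiableAt.hasFDerivAt.sub
    (h.self_of_nhds.1.differentiableAt.hasDerivAt.comp_hasFDerivAt y hfoot)).pow 3
  have hd := (hfoot.congr_of_eventuallyEq (h.mono fun _ hw => hw.2)).unique hcube
  have key (v : ℂ × ℂ) : 3 * (u y - a₀ (y.2 + y.1 * u y)) ^ 2 *
      (fderiv ℂ u y v - deriv a₀ (y.2 + y.1 * u y) * (v.2 + (y.1 * fderiv ℂ u y v + u y * v.1))) =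
      v.2 + (y.1 * fderiv ℂ u y v + u y * v.1) := by
    have := congrArg (fun L => L v) hd
    simp only [add_apply, ContinuousLinearMap.coe_snd', smul_apply, smul_eq_mul,
      ContinuousLinearMap.coe_fst', Pi.sub_apply, Function.comp_apply, Pi.add_apply, Pi.mul_apply,
      Nat.add_one_sub_one, nsmul_eq_mul, Nat.cast_ofNat, smul_add, sub_apply] at this
    linear_combination -this
  have ht := key (1, 0)
  have hx := key (0, 1)
  simp only [timeDeriv, spaceDeriv]
  generalize fderiv ℂ u y (1, 0) = ut at *
  generalize fderiv ℂ u y (0, 1) = ux at *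
  generalize deriv a₀ (y.2 + y.1 * u y) = α at *
  generalize 3 * (u y - a₀ (y.2 + y.1 * u y)) ^ 2 = k at *
  have hprod : (k - y.1 * (1 + k * α)) * (ut - u y * ux) = 0 := by
    linear_combination ht - u y * hx
  refine (mul_eq_zero.1 hprod).resolve_left fun h0 => ?_
  have h1 : 1 + k * α = 0 := by linear_combination -hx + ux * h0
  have hk : k = 0 := by linear_combination h0 + y.1 * h1
  simp [hk] at h1

theorem exists_cubicFamily {a₀ : ℂ → ℂ} (ha₀ : AnalyticAt ℂ a₀ 0) :
    ∃ a p q : ℂ × ℂ → ℂ, HolomorphicTripleAt a p q (0, 0) ∧ HasInitialValues a₀ a p q 0 ∧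
      ∀ᶠ w in 𝓝 ((0, 0) : ℂ × ℂ), ∀ z, IsCubicRootNear p q z w →
        SolvesBurgersNear (fun v => a v + z v) w := by
  obtain ⟨a, p, q, htriple, hinit, himp⟩ := exists_solvesImplicit ha₀
  refine ⟨a, p, q, htriple, hinit, ?_⟩
  filter_upwards [htriple.eventually, eventually_eventually_nhds.2 himp] with w hw himp z hz
  refine ⟨hw.1.add hz.1, ?_⟩
  filter_upwards [hw.1.eventually_analyticAt, hz.eventually, eventually_eventually_nhds.2 himp]
    with v hav hzv himp
  refine burgers_of_solvesImplicit (a₀ := a₀) (hav.add hzv.1) ?_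
  filter_upwards [himp, hzv.2] with v' himp hzv
  exact himp _ hzv

/-! ### Irreducibility of the cubic and the system satisfied by the coefficients -/

/-- The norm of `A + B z + C z ^ 2` over the base ring, where `z ^ 3 = p z + q`: the determinant of
multiplication by this element on the basis `1, z, z ^ 2`. -/
def cubicNorm {R : Type*} [CommRing R] (p q A B C : R) : R :=
  A * (A ^ 2 + 2 * A * C * p + C ^ 2 * p ^ 2 - B ^ 2 * p - 3 * B * C * q) +
    q * (B ^ 3 - p * B * C ^ 2 + C ^ 3 * q)

theorem cubicNorm_eq_zero_of_root {R : Type*} [CommRing R] {p q A B C z : R}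
    (hz : z ^ 3 = p * z + q) (h : A + B * z + C * z ^ 2 = 0) : cubicNorm p q A B C = 0 := by
  obtain rfl : q = z ^ 3 - p * z := by linear_combination -hz
  unfold cubicNorm
  linear_combination (A ^ 2 - A * B * z + A * C * (2 * p - z ^ 2) + B ^ 2 * (z ^ 2 - p)
    - B * C * z * (z ^ 2 - p) + C ^ 2 * (z ^ 2 - p) ^ 2) * h

theorem cubicNorm_mul {R : Type*} [CommRing R] (p q A B C x : R) :
    cubicNorm p q (x * A) (x * B) (x * C) = x ^ 3 * cubicNorm p q A B C := by
  unfold cubicNorm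
  ring

section OneVariable

variable {𝕜 : Type*} [NontriviallyNormedField 𝕜]

theorem exists_eventually_eq_mul_of_apply_eq_zero {f : 𝕜 → 𝕜} (hf : AnalyticAt 𝕜 f 0)
    (h0 : f 0 = 0) : ∃ g, AnalyticAt 𝕜 g 0 ∧ ∀ᶠ x in 𝓝 (0 : 𝕜), f x = x * g x := by
  have h1 : ((1 : ℕ) : ℕ∞) ≤ analyticOrderAt f 0 := by
    rw [Nat.cast_one, Order.one_le_iff_ne_zero]
    exact hf.analyticOrderAt_ne_zero.2 h0
  obtain ⟨g, hg, h⟩ := (natCast_le_analyticOrderAt hf).1 h1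
  exact ⟨g, hg, h.mono fun x hx => by simpa using hx⟩

theorem eventually_eq_zero_of_eventually_pow_mul_eq_zero {f : 𝕜 → 𝕜} (hf : AnalyticAt 𝕜 f 0)
    {n : ℕ} (h : ∀ᶠ x in 𝓝 (0 : 𝕜), x ^ n * f x = 0) : ∀ᶠ x in 𝓝 (0 : 𝕜), f x = 0 := by
  refine hf.frequently_zero_iff_eventually_zero.1 (Eventually.frequently ?_)
  filter_upwards [h.filter_mono nhdsWithin_le_nhds, self_mem_nhdsWithin] with x hx hx0
  exact (mul_eq_zero.1 hx).resolve_left (pow_ne_zero _ hx0)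

theorem succ_le_analyticOrderAt_of_eventually_eq_mul {f g : 𝕜 → 𝕜} (hg : AnalyticAt 𝕜 g 0)
    (hfg : ∀ᶠ x in 𝓝 (0 : 𝕜), f x = x * g x) {n : ℕ} (hn : n ≤ analyticOrderAt g 0) :
    (n + 1 : ℕ) ≤ analyticOrderAt f 0 := by
  obtain ⟨k, hk, hgk⟩ := (natCast_le_analyticOrderAt hg).1 hn
  have hf : AnalyticAt 𝕜 f 0 := (analyticAt_id.mul hg).congr (hfg.mono fun _ h => h.symm)
  refine (natCast_le_analyticOrderAt hf).2 ⟨k, hk, ?_⟩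
  filter_upwards [hfg, hgk] with x hfx hgx
  rw [hfx, hgx, sub_zero, pow_succ', smul_eq_mul, smul_eq_mul, mul_assoc]

variable {p q A B C : 𝕜 → 𝕜} (hp : AnalyticAt 𝕜 p 0) (hq : AnalyticAt 𝕜 q 0) (hp0 : p 0 = 0)
  (hq0 : q 0 = 0) (hq' : deriv q 0 ≠ 0) (hA : AnalyticAt 𝕜 A 0) (hB : AnalyticAt 𝕜 B 0)
  (hC : AnalyticAt 𝕜 C 0) (hN : ∀ᶠ x in 𝓝 (0 : 𝕜), cubicNorm (p x) (q x) (A x) (B x) (C x) = 0)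

include hp hq hp0 hq0 hq' hA hB hC hN

-- The terms `A ^ 3`, `q B ^ 3` and `q ^ 2 C ^ 3` of the norm have orders `0`, `1` and `2` modulo
-- three, so none of them can cancel the others: `A`, `B` and `C` vanish one after the other.
theorem apply_eq_zero_of_cubicNorm_eq_zero : A 0 = 0 ∧ B 0 = 0 ∧ C 0 = 0 := by
  obtain ⟨p₁, hp₁, hpx⟩ := exists_eventually_eq_mul_of_apply_eq_zero hp hp0
  obtain ⟨q₁, hq₁, hqx⟩ := exists_eventually_eq_mul_of_apply_eq_zero hq hq0
  have hq₁0 : q₁ 0 ≠ 0 := by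
    have h : HasDerivAt q (q₁ 0) 0 := by
      have := (hasDerivAt_id (0 : 𝕜)).mul hq₁.differentiableAt.hasDerivAt
      simpa using this.congr_of_eventuallyEq hqx
    rwa [← h.deriv]
  have hA0 : A 0 = 0 := by
    simpa [cubicNorm, hp0, hq0, ← pow_succ'] using hN.self_of_nhds
  obtain ⟨A₁, hA₁, hAx⟩ := exists_eventually_eq_mul_of_apply_eq_zero hA hA0
  have hB0 : B 0 = 0 := by
    have h := eventually_eq_zero_of_eventually_pow_mul_eq_zero (n := 1) (f := fun x =>
      A₁ x * (A x ^ 2 + 2 * A x * C x * p x + C x ^ 2 * p x ^ 2 - B x ^ 2 * p x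
        - 3 * B x * C x * q x) + q₁ x * (B x ^ 3 - p x * B x * C x ^ 2 + C x ^ 3 * q x))
      (by fun_prop) (by
        filter_upwards [hN, hAx, hqx] with x hN hAx hqx
        unfold cubicNorm at hN
        linear_combination hN - (A x ^ 2 + 2 * A x * C x * p x + C x ^ 2 * p x ^ 2
          - B x ^ 2 * p x - 3 * B x * C x * q x) * hAx
          - (B x ^ 3 - p x * B x * C x ^ 2 + C x ^ 3 * q x) * hqx)
    simpa [hA0, hp0, hq0, hq₁0] using h.self_of_nhds
  obtain ⟨B₁, hB₁, hBx⟩ := exists_eventually_eq_mul_of_apply_eq_zero hB hB0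
  refine ⟨hA0, hB0, ?_⟩
  have h := eventually_eq_zero_of_eventually_pow_mul_eq_zero (n := 2) (f := fun x =>
    x * A₁ x * (A₁ x ^ 2 + 2 * A₁ x * C x * p₁ x + C x ^ 2 * p₁ x ^ 2 - x * B₁ x ^ 2 * p₁ x
      - 3 * B₁ x * C x * q₁ x)
      + q₁ x * (x ^ 2 * B₁ x ^ 3 - x * p₁ x * B₁ x * C x ^ 2 + C x ^ 3 * q₁ x))
    (by fun_prop) (by
      filter_upwards [hN, hAx, hBx, hpx, hqx] with x hN hAx hBx hpx hqx
      rw [hAx, hBx, hpx, hqx, cubicNorm] at hN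
      linear_combination hN)
  simpa [hq₁0] using h.self_of_nhds

theorem natCast_le_analyticOrderAt_of_cubicNorm_eq_zero (n : ℕ) :
    n ≤ analyticOrderAt A 0 ∧ n ≤ analyticOrderAt B 0 ∧ n ≤ analyticOrderAt C 0 := by
  induction n generalizing A B C with
  | zero => simp
  | succ n ih =>
    obtain ⟨hA0, hB0, hC0⟩ := apply_eq_zero_of_cubicNorm_eq_zero hp hq hp0 hq0 hq' hA hB hC hN
    obtain ⟨A₁, hA₁, hAx⟩ := exists_eventually_eq_mul_of_apply_eq_zero hA hA0
    obtain ⟨B₁, hB₁, hBx⟩ := exists_eventually_eq_mul_of_apply_eq_zero hB hB0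
    obtain ⟨C₁, hC₁, hCx⟩ := exists_eventually_eq_mul_of_apply_eq_zero hC hC0
    have hN₁ := eventually_eq_zero_of_eventually_pow_mul_eq_zero (n := 3)
      (f := fun x => cubicNorm (p x) (q x) (A₁ x) (B₁ x) (C₁ x))
      (by unfold cubicNorm; fun_prop) (by
        filter_upwards [hN, hAx, hBx, hCx] with x hN hAx hBx hCx
        rwa [hAx, hBx, hCx, cubicNorm_mul] at hN)
    obtain ⟨hAn, hBn, hCn⟩ := ih hA₁ hB₁ hC₁ hN₁
    exact ⟨succ_le_analyticOrderAt_of_eventually_eq_mul hA₁ hAx hAn,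
      succ_le_analyticOrderAt_of_eventually_eq_mul hB₁ hBx hBn,
      succ_le_analyticOrderAt_of_eventually_eq_mul hC₁ hCx hCn⟩

theorem eventually_eq_zero_of_cubicNorm_eq_zero :
    ∀ᶠ x in 𝓝 (0 : 𝕜), A x = 0 ∧ B x = 0 ∧ C x = 0 := by
  have horder := natCast_le_analyticOrderAt_of_cubicNorm_eq_zero hp hq hp0 hq0 hq' hA hB hC hN
  have hzero {f : 𝕜 → 𝕜} (h : ∀ n : ℕ, n ≤ analyticOrderAt f 0) : ∀ᶠ x in 𝓝 0, f x = 0 :=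
    analyticOrderAt_eq_top.1 (ENat.eq_top_iff_forall_ge.2 h)
  exact (hzero fun n => (horder n).1).and
    ((hzero fun n => (horder n).2.1).and (hzero fun n => (horder n).2.2))

end OneVariable

theorem eventuallyEq_zero_of_cubicNorm_eq_zero {E : Type*} [NormedAddCommGroup E]
    [NormedSpace ℂ E] {p q A B C : E → ℂ} {e : E} (hp : AnalyticAt ℂ p 0) (hq : AnalyticAt ℂ q 0)
    (hp0 : p 0 = 0) (hq0 : q 0 = 0) (hq' : fderiv ℂ q 0 e ≠ 0) (hA : AnalyticAt ℂ A 0)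
    (hB : AnalyticAt ℂ B 0) (hC : AnalyticAt ℂ C 0)
    (hN : ∀ᶠ w in 𝓝 0, cubicNorm (p w) (q w) (A w) (B w) (C w) = 0) :
    A =ᶠ[𝓝 0] 0 ∧ B =ᶠ[𝓝 0] 0 ∧ C =ᶠ[𝓝 0] 0 := by
  have hline : ∀ᶠ v in 𝓝 e,
      ∀ᶠ τ in 𝓝 (0 : ℂ), A (τ • v) = 0 ∧ B (τ • v) = 0 ∧ C (τ • v) = 0 := by
    filter_upwards [(fderiv ℂ q 0).continuous.continuousAt.eventually_ne hq'] with v hv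
    have hτv : AnalyticAt ℂ (fun τ : ℂ => τ • v) 0 := analyticAt_id.smul analyticAt_const
    have hlim : Tendsto (fun τ : ℂ => τ • v) (𝓝 0) (𝓝 0) := by
      simpa [ContinuousAt] using hτv.continuousAt
    have restrict {f : E → ℂ} (hf : AnalyticAt ℂ f 0) : AnalyticAt ℂ (fun τ : ℂ => f (τ • v)) 0 :=
      hf.comp_of_eq hτv (zero_smul ℂ v)
    have hderiv : HasDerivAt (fun τ : ℂ => q (τ • v)) (fderiv ℂ q 0 v) 0 := by
      have hτ : HasDerivAt (fun τ : ℂ => τ • v) v 0 := by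
        simpa using (hasDerivAt_id (0 : ℂ)).smul_const v
      exact hq.differentiableAt.hasFDerivAt.comp_hasDerivAt_of_eq 0 hτ (zero_smul ℂ v).symm
    exact eventually_eq_zero_of_cubicNorm_eq_zero (restrict hp) (restrict hq) (by simpa using hp0)
      (by simpa using hq0) (by rwa [hderiv.deriv]) (restrict hA) (restrict hB) (restrict hC)
      (hlim.eventually hN)
  exact ⟨eventuallyEq_zero_of_eventually_lines hA (hline.mono fun _ h => h.mono fun _ h => h.1),
    eventuallyEq_zero_of_eventually_lines hB (hline.mono fun _ h => h.mono fun _ h => h.2.1),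
    eventuallyEq_zero_of_eventually_lines hC (hline.mono fun _ h => h.mono fun _ h => h.2.2)⟩

section InitialValues

variable {a₀ : ℂ → ℂ} {a p q : ℂ × ℂ → ℂ}

theorem HasInitialValues.eventually {x₀ : ℂ} (h : HasInitialValues a₀ a p q x₀) :
    ∀ᶠ x in 𝓝 x₀, HasInitialValues a₀ a p q x :=
  eventually_eventually_nhds.2 h

theorem HasInitialValues.spaceDeriv_p (h : HasInitialValues a₀ a p q 0)
    (hp : AnalyticAt ℂ p (0, 0)) : spaceDeriv p (0, 0) = 0 := by
  refine fderiv_apply_inr hp.differentiableAt ?_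
  refine (hasDerivAt_const 0 0).congr_of_eventuallyEq ?_
  filter_upwards [h] with x hx
  simpa using hx.2.1

theorem HasInitialValues.spaceDeriv_q (h : HasInitialValues a₀ a p q 0)
    (hq : AnalyticAt ℂ q (0, 0)) : spaceDeriv q (0, 0) = 1 := by
  refine fderiv_apply_inr hq.differentiableAt ?_
  refine (hasDerivAt_id 0).congr_of_eventuallyEq ?_
  filter_upwards [h] with x hx
  simpa using hx.2.2

theorem HolomorphicNearOrigin.cubicNorm_coeff_eq_zero {U : Set (ℂ × ℂ)}
    (h : HolomorphicNearOrigin U a p q) {y : ℂ × ℂ} (hy : y ∈ U) {z : ℂ × ℂ → ℂ}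
    (hz : IsCubicRootNear p q z y) (hu : SolvesBurgersNear (fun w => a w + z w) y) :
    ∀ w ∈ U, cubicNorm (p w) (q w) (coeffZero a p q w) (coeffOne a p q w) (coeffTwo a p w) = 0 := by
  have han : AnalyticOnNhd ℂ (fun w => cubicNorm (p w) (q w) (coeffZero a p q w)
      (coeffOne a p q w) (coeffTwo a p w)) U := fun w hw => by
    have htriple := h.holomorphicTripleAt hw
    have h0 := htriple.analyticAt_coeffZero
    have h1 := htriple.analyticAt_coeffOne
    have h2 := htriple.analyticAt_coeffTwo
    obtain ⟨-, hp, hq⟩ := htriple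
    unfold cubicNorm
    fun_prop
  refine fun w hw => han.eqOn_zero_of_preconnected_of_eventuallyEq_zero h.isPreconnected hy ?_ hw
  filter_upwards [hz.eventually, hu.2, h.isOpen.mem_nhds hy] with w hz hu hw
  refine cubicNorm_eq_zero_of_root hz.self ?_
  rw [← (h.holomorphicTripleAt hw).burgers_add_root hz, hu, mul_zero]

theorem HolomorphicNearOrigin.eventually_coeffSystemAt_of_exists_branch {U : Set (ℂ × ℂ)}
    (h : HolomorphicNearOrigin U a p q) (hinit : HasInitialValues a₀ a p q 0) {y : ℂ × ℂ}
    (hy : y ∈ U) {z : ℂ × ℂ → ℂ} (hz : IsCubicRootNear p q z y)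
    (hu : SolvesBurgersNear (fun w => a w + z w) y) :
    ∀ᶠ w in 𝓝 ((0, 0) : ℂ × ℂ), CoeffSystemAt a p q w := by
  have htriple := h.holomorphicTripleAt h.zero_mem
  obtain ⟨-, hp0, hq0⟩ := hinit.self_of_nhds
  have hq' : fderiv ℂ q 0 (0, 1) ≠ 0 := (hinit.spaceDeriv_q htriple.3).trans_ne one_ne_zero
  obtain ⟨h0, h1, h2⟩ := eventuallyEq_zero_of_cubicNorm_eq_zero htriple.2 htriple.3 hp0 hq0 hq'
    htriple.analyticAt_coeffZero htriple.analyticAt_coeffOne htriple.analyticAt_coeffTwo <|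
    eventually_of_mem (h.isOpen.mem_nhds h.zero_mem) (h.cubicNorm_coeff_eq_zero hy hz hu)
  exact h0.and (h1.and h2)

end InitialValues

theorem HolomorphicTripleAt.eventually_coeffSystemAt {a₀ : ℂ → ℂ} {a p q : ℂ × ℂ → ℂ}
    (h : HolomorphicTripleAt a p q (0, 0)) (hinit : HasInitialValues a₀ a p q 0)
    (hsol : ∀ᶠ w in 𝓝 ((0, 0) : ℂ × ℂ), ∀ z, IsCubicRootNear p q z w →
      SolvesBurgersNear (fun v => a v + z v) w) :
    ∀ᶠ w in 𝓝 ((0, 0) : ℂ × ℂ), CoeffSystemAt a p q w := by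
  obtain ⟨R, hR, hball⟩ := Metric.eventually_nhds_iff_ball.1 (h.eventually.and hsol)
  have hholo : HolomorphicNearOrigin (Metric.ball (0, 0) R) a p q :=
    ⟨Metric.isOpen_ball, (convex_ball _ _).isPreconnected, Metric.mem_ball_self hR,
      fun w hw => (hball w hw).1.1, fun w hw => (hball w hw).1.2, fun w hw => (hball w hw).1.3⟩
  have hmem : ∀ᶠ w in 𝓝 ((0, 0) : ℂ × ℂ), w ∈ Metric.ball (0, 0) R := Metric.ball_mem_nhds _ hR
  obtain ⟨x, ⟨hx, -, hpx, hqx⟩, hx0⟩ :=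
    ((hmem.curry_nhds.self_of_nhds.and hinit).filter_mono nhdsWithin_le_nhds |>.and
      (self_mem_nhdsWithin (s := {(0 : ℂ)}ᶜ))).exists
  obtain ⟨ζ, hζ⟩ := IsAlgClosed.exists_pow_nat_eq x three_pos
  have hζ0 : ζ ≠ 0 := by
    rintro rfl
    simp [← hζ] at hx0
  obtain ⟨z, hz, -⟩ := exists_isCubicRootNear (hball _ hx).1.2 (hball _ hx).1.3
    (ζ := ζ) (by simp [hpx, hqx, hζ]) (by simpa [hpx])
  exact hholo.eventually_coeffSystemAt_of_exists_branch hinit hx hz ((hball _ hx).2 z hz)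

/-! ### Uniqueness of the coefficients -/

theorem exists_injective_pow_eq {n : ℕ} (hn : n ≠ 0) {x : ℂ} (hx : x ≠ 0) :
    ∃ ζ : Fin n → ℂ, Function.Injective ζ ∧ ∀ i, ζ i ^ n = x := by
  obtain ⟨c, rfl⟩ := IsAlgClosed.exists_pow_nat_eq x (Nat.pos_of_ne_zero hn)
  have hμ := Complex.isPrimitiveRoot_exp n hn
  refine ⟨fun i => c * Complex.exp (2 * Real.pi * Complex.I / n) ^ (i : ℕ), fun i j hij => ?_,
    fun i => ?_⟩
  · exact Fin.ext (hμ.pow_inj i.2 j.2 (mul_left_cancel₀ (ne_zero_pow hn hx) hij))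
  · rw [mul_pow, ← pow_mul, mul_comm (i : ℕ), pow_mul, hμ.pow_eq_one, one_pow, mul_one]

theorem eq_of_translated_cubic_roots {R : Type*} [CommRing R] [IsDomain R] (h3 : (3 : R) ≠ 0)
    {p q p' q' d : R} {z : Fin 3 → R} (hz : Function.Injective z)
    (h : ∀ i, z i ^ 3 = p * z i + q) (h' : ∀ i, (z i + d) ^ 3 = p' * (z i + d) + q') :
    d = 0 ∧ p' = p ∧ q' = q := by
  have hcoeff := Matrix.eq_zero_of_forall_index_sum_pow_mul_eq_zero
    (v := ![q + d ^ 3 - p' * d - q', p + 3 * d ^ 2 - p', 3 * d]) hz fun i => by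
      simp only [Fin.sum_univ_three, Matrix.cons_val, Fin.val_zero, Fin.val_one, Fin.val_two,
        pow_zero, pow_one]
      linear_combination h' i - h i
  have h0 := congrFun hcoeff 0
  have h1 := congrFun hcoeff 1
  have hd : d = 0 := (mul_eq_zero.1 (congrFun hcoeff 2)).resolve_left h3
  simp only [hd, Matrix.cons_val, Pi.zero_apply] at h0 h1
  exact ⟨hd, by linear_combination -h1, by linear_combination -h0⟩

theorem exists_isCubeRootGerm {ζ : ℂ} (hζ : ζ ≠ 0) :
    ∃ ω, IsCubeRootGerm ω (ζ ^ 3) ∧ ω (ζ ^ 3) = ζ := by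
  obtain ⟨z, hz, hzζ, -⟩ := exists_isCubicRootNear (p := 0) (q := Prod.snd) (y := (0, ζ ^ 3))
    analyticAt_const analyticAt_snd (ζ := ζ) (by simp) (by simpa)
  refine ⟨fun x => z (0, x), ⟨?_, ?_⟩, hzζ⟩
  · have := hz.1
    fun_prop
  · simpa using hz.2.curry_nhds.self_of_nhds

section InitialValueProblem

variable {a₀ : ℂ → ℂ} {a p q a' p' q' : ℂ × ℂ → ℂ} {x₀ : ℂ}

theorem HolomorphicTripleAt.exists_solvesIVP (h : HolomorphicTripleAt a p q (0, x₀))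
    (hinit : HasInitialValues a₀ a p q x₀)
    (hsys : ∀ᶠ w in 𝓝 (0, x₀), CoeffSystemAt a p q w) (hx₀ : x₀ ≠ 0) {ω : ℂ → ℂ}
    (hω : IsCubeRootGerm ω x₀) :
    ∃ z, IsCubicRootNear p q z (0, x₀) ∧ z (0, x₀) = ω x₀ ∧
      SolvesIVP a₀ ω x₀ (fun w => a w + z w) := by
  obtain ⟨-, hp, hq⟩ := hinit.self_of_nhds
  have hω₀ : ω x₀ ≠ 0 := fun h0 => hx₀ (by simpa [h0] using hω.2.self_of_nhds.symm)
  have hsimple : 3 * ω x₀ ^ 2 ≠ p (0, x₀) := by simpa [hp]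
  obtain ⟨z, hz, hzω, hu⟩ := exists_isCubicRootNear h.2 h.3
    (by rw [hω.2.self_of_nhds, hp, hq, zero_mul, zero_add]) hsimple
  refine ⟨z, hz, hzω, h.solvesBurgersNear_of_coeffSystemAt hsys hz (hzω ▸ hsimple), ?_⟩
  have ht : Tendsto (fun x : ℂ => (((0, x), ω x) : (ℂ × ℂ) × ℂ)) (𝓝 x₀) (𝓝 ((0, x₀), ω x₀)) :=
    (Continuous.prodMk_right (0 : ℂ)).continuousAt.tendsto.prodMk_nhds hω.1.continuousAt
  filter_upwards [hinit, hω.2, ht.eventually hu] with x ⟨hax, hpx, hqx⟩ hωx hux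
  rw [hax, ← hux (by rw [hpx, hqx, hωx]; ring)]

theorem HolomorphicTripleAt.eventuallyEq_of_ne_zero (h : HolomorphicTripleAt a p q (0, x₀))
    (h' : HolomorphicTripleAt a' p' q' (0, x₀)) (hinit : HasInitialValues a₀ a p q x₀)
    (hinit' : HasInitialValues a₀ a' p' q' x₀) (hsys : ∀ᶠ w in 𝓝 (0, x₀), CoeffSystemAt a p q w)
    (hsys' : ∀ᶠ w in 𝓝 (0, x₀), CoeffSystemAt a' p' q' w) (hx₀ : x₀ ≠ 0) :
    a' =ᶠ[𝓝 (0, x₀)] a ∧ p' =ᶠ[𝓝 (0, x₀)] p ∧ q' =ᶠ[𝓝 (0, x₀)] q := by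
  obtain ⟨ζ, hζinj, hζ⟩ := exists_injective_pow_eq three_ne_zero hx₀
  have hbranch (i : Fin 3) : ∃ z, IsCubicRootNear p q z (0, x₀) ∧ z (0, x₀) = ζ i ∧
      ∀ᶠ w in 𝓝 (0, x₀), (z w + (a w - a' w)) ^ 3 = p' w * (z w + (a w - a' w)) + q' w := by
    have hζ0 : ζ i ≠ 0 := fun h0 => hx₀ (by simpa [h0] using (hζ i).symm)
    obtain ⟨ω, hω, hωζ⟩ := exists_isCubeRootGerm hζ0
    rw [hζ i] at hω hωζ
    obtain ⟨z, hz, hzω, hu⟩ := h.exists_solvesIVP hinit hsys hx₀ hω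
    obtain ⟨z', hz', -, hu'⟩ := h'.exists_solvesIVP hinit' hsys' hx₀ hω
    refine ⟨z, hz, hzω.trans hωζ, ?_⟩
    filter_upwards [hu.eventuallyEq hu', hz'.2] with w hw hz'
    rwa [show z w + (a w - a' w) = z' w by linear_combination hw]
  choose z hz hzζ hz' using hbranch
  have hinj : ∀ᶠ w in 𝓝 (0, x₀), ∀ i j, i ≠ j → z i w ≠ z j w :=
    eventually_all.2 fun i => eventually_all.2 fun j => by
      by_cases hij : i = j
      · simp [hij]
      · have hne : z i (0, x₀) ≠ z j (0, x₀) := by rw [hzζ, hzζ]; exact hζinj.ne hij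
        exact ((ContinuousAt.ne_iff_eventually_ne (hz i).1.continuousAt
          (hz j).1.continuousAt).1 hne).mono fun _ h _ => h
  have heq : ∀ᶠ w in 𝓝 (0, x₀), a w - a' w = 0 ∧ p' w = p w ∧ q' w = q w := by
    filter_upwards [hinj, eventually_all.2 fun i => (hz i).2, eventually_all.2 hz']
      with w hw hzw hzw'
    exact eq_of_translated_cubic_roots three_ne_zero (z := fun i => z i w)
      (fun i j => not_imp_not.1 (hw i j)) hzw hzw'
  exact ⟨heq.mono fun _ h => (sub_eq_zero.1 h.1).symm, heq.mono fun _ h => h.2.1,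
    heq.mono fun _ h => h.2.2⟩

theorem HolomorphicTripleAt.eventuallyEq (h : HolomorphicTripleAt a p q (0, 0))
    (h' : HolomorphicTripleAt a' p' q' (0, 0)) (hinit : HasInitialValues a₀ a p q 0)
    (hinit' : HasInitialValues a₀ a' p' q' 0)
    (hsys : ∀ᶠ w in 𝓝 ((0, 0) : ℂ × ℂ), CoeffSystemAt a p q w)
    (hsys' : ∀ᶠ w in 𝓝 ((0, 0) : ℂ × ℂ), CoeffSystemAt a' p' q' w) :
    a' =ᶠ[𝓝 (0, 0)] a ∧ p' =ᶠ[𝓝 (0, 0)] p ∧ q' =ᶠ[𝓝 (0, 0)] q := by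
  have hnear := (h.eventually.and h'.eventually).and <|
    (eventually_eventually_nhds.2 hsys).and <| (eventually_eventually_nhds.2 hsys').and <|
    (eventually_eventuallyEq_zero_iff (h'.1.sub h.1)).and <|
    (eventually_eventuallyEq_zero_iff (h'.2.sub h.2)).and
      (eventually_eventuallyEq_zero_iff (h'.3.sub h.3))
  obtain ⟨x, ⟨⟨⟨hx, hx'⟩, hsx, hsx', ia, ip, iq⟩, hix, hix'⟩, hx0⟩ :=
    ((hnear.curry_nhds.self_of_nhds.and (hinit.eventually.and hinit'.eventually)).filter_mono
      nhdsWithin_le_nhds |>.and (self_mem_nhdsWithin (s := {(0 : ℂ)}ᶜ))).exists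
  obtain ⟨ea, ep, eq⟩ := hx.eventuallyEq_of_ne_zero hx' hix hix' hsx hsx' hx0
  simp only [← eventuallyEq_iff_sub] at ia ip iq
  exact ⟨ia.1 ea, ip.1 ep, iq.1 eq⟩

end InitialValueProblem

/-! ### Continuation of the roots of a cubic along a path -/

/-- The surface of triples `(P, Q, z)` with `z ^ 3 = P z + Q`, in coordinates `(P, z)`,
projected to `(P, Q)`. -/
def rootProjection (v : ℂ × ℂ) : ℂ × ℂ := (v.1, v.2 ^ 3 - v.1 * v.2)

theorem rootProjection_eq_iff {P z : ℂ} {c : ℂ × ℂ} :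
    rootProjection (P, z) = c ↔ P = c.1 ∧ z ^ 3 = c.1 * z + c.2 := by
  rw [Prod.ext_iff]
  refine and_congr_right fun h => ?_
  dsimp only [rootProjection] at h ⊢
  rw [h, sub_eq_iff_eq_add']

@[fun_prop]
theorem continuous_rootProjection : Continuous rootProjection := by
  unfold rootProjection
  fun_prop

theorem isProperMap_rootProjection : IsProperMap rootProjection := by
  refine isProperMap_iff_isCompact_preimage.2 ⟨continuous_rootProjection, fun K hK => ?_⟩
  refine Metric.isCompact_of_isClosed_isBounded (hK.isClosed.preimage continuous_rootProjection) ?_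
  obtain ⟨R, hR⟩ := hK.isBounded.exists_norm_le
  refine isBounded_iff_forall_norm_le.2 ⟨R + R + 1, fun v hv => ?_⟩
  have hP : ‖v.1‖ ≤ R := (norm_fst_le (rootProjection v)).trans (hR _ hv)
  have hQ : ‖v.2 ^ 3 - v.1 * v.2‖ ≤ R := (norm_snd_le (rootProjection v)).trans (hR _ hv)
  have hz := norm_cubic_root_le (add_sub_cancel (v.1 * v.2) (v.2 ^ 3)).symm
  exact max_le (by linarith [norm_nonneg v.1]) (by linarith)

theorem fderiv_rootProjection (v w : ℂ × ℂ) :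
    fderiv ℂ rootProjection v w = (w.1, (3 * v.2 ^ 2 - v.1) * w.2 - v.2 * w.1) := by
  have h1 := hasFDerivAt_fst (𝕜 := ℂ) (p := v)
  have h2 := hasFDerivAt_snd (𝕜 := ℂ) (p := v)
  have h : HasFDerivAt rootProjection _ v := h1.prodMk ((h2.pow 3).sub (h1.mul h2))
  rw [h.fderiv]
  ext
  · simp
  · simp only [Nat.add_one_sub_one, nsmul_eq_mul, Nat.cast_ofNat, ContinuousLinearMap.prod_apply,
      ContinuousLinearMap.coe_fst', sub_apply, smul_apply, ContinuousLinearMap.coe_snd',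
      smul_eq_mul, add_apply]
    ring

theorem isCoveringMapOn_rootProjection :
    IsCoveringMapOn rootProjection {c | 4 * c.1 ^ 3 - 27 * c.2 ^ 2 ≠ 0} := by
  have hloc : ∀ e ∈ rootProjection ⁻¹' {c | 4 * c.1 ^ 3 - 27 * c.2 ^ 2 ≠ 0},
      ∃ φ : OpenPartialHomeomorph (ℂ × ℂ) (ℂ × ℂ), e ∈ φ.source ∧ ⇑φ = rootProjection := by
    intro e he
    have hs : 3 * e.2 ^ 2 ≠ e.1 :=
      three_mul_sq_ne_of_discr_ne_zero (rootProjection_eq_iff.1 rfl).2 he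
    have han : AnalyticAt ℂ rootProjection e := by unfold rootProjection; fun_prop
    obtain ⟨φ, -, -, hφ, heφ, -⟩ := exists_openPartialHomeomorph_target_eq_ball han (fun w hw => by
      rw [fderiv_rootProjection, Prod.mk_eq_zero] at hw
      obtain ⟨h1, h2⟩ := hw
      rw [h1, mul_zero, sub_zero, mul_eq_zero] at h2
      exact Prod.ext h1 (h2.resolve_left (sub_ne_zero.2 hs)))
      (Eventually.of_forall fun _ => trivial)
    exact ⟨φ, heφ, hφ⟩
  refine isProperMap_rootProjection.isClosedMap.isCoveringMapOn_of_isLocalHomeomorphOn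
    (fun c hc => ?_) (fun e he => ?_)
  · refine (isProperMap_rootProjection.isCompact_preimage isCompact_singleton).finite
      (IsDiscrete.of_openPartialHomeomorph rootProjection subset_rfl fun e he => hloc e ?_)
    rw [Set.mem_preimage, Set.mem_singleton_iff.1 he]
    exact hc
  · obtain ⟨φ, heφ, hφ⟩ := hloc e he
    exact ⟨φ, heφ, hφ.symm⟩

theorem exists_continuous_cubic_root {P Q : unitInterval → ℂ} (hP : Continuous P)
    (hQ : Continuous Q) (hD : ∀ s, 4 * P s ^ 3 - 27 * Q s ^ 2 ≠ 0) {ζ₀ : ℂ}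
    (h₀ : ζ₀ ^ 3 = P 0 * ζ₀ + Q 0) :
    ∃ ζ : unitInterval → ℂ, Continuous ζ ∧ ζ 0 = ζ₀ ∧ ∀ s, ζ s ^ 3 = P s * ζ s + Q s := by
  have hbase : rootProjection (P 0, ζ₀) = (P 0, Q 0) := rootProjection_eq_iff.2 ⟨rfl, h₀⟩
  obtain ⟨F, hF, hF0⟩ :=
    isCoveringMapOn_rootProjection.isCoveringMap_restrictPreimage.exists_path_lifts
      ⟨fun s => ⟨(P s, Q s), hD s⟩, by fun_prop⟩
      ⟨(P 0, ζ₀), by rw [Set.mem_preimage, hbase]; exact hD 0⟩ (Subtype.ext hbase.symm)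
  refine ⟨fun s => (F s).1.2, by fun_prop, by simp [hF0], fun s => ?_⟩
  exact (rootProjection_eq_iff.1 (congrArg Subtype.val (congrFun hF s))).2

section Continuation

variable {a p q : ℂ × ℂ → ℂ} {y₀ y₁ : ℂ × ℂ} {γ : Path y₀ y₁}

theorem exists_isContinuationAlong_of_roots (h : ∀ s, HolomorphicTripleAt a p q (γ s))
    (hD : ∀ s, discr p q (γ s) ≠ 0) {ζ : unitInterval → ℂ} (hζc : Continuous ζ)
    (hζ : ∀ s, ζ s ^ 3 = p (γ s) * ζ s + q (γ s)) :
    ∃ z : unitInterval → ℂ × ℂ → ℂ, IsContinuationAlong γ (fun s w => a w + z s w) ∧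
      ∀ s, IsCubicRootNear p q (z s) (γ s) ∧ z s (γ s) = ζ s := by
  have hs : ∀ s, 3 * ζ s ^ 2 ≠ p (γ s) := fun s => three_mul_sq_ne_of_discr_ne_zero (hζ s) (hD s)
  choose z hz hzζ hzu using fun s => exists_isCubicRootNear (h s).2 (h s).3 (hζ s) (hs s)
  refine ⟨z, ⟨fun s => (h s).1.add (hz s).1, fun s => ?_⟩, fun s => ⟨hz s, hzζ s⟩⟩
  have ht : Tendsto (fun r => (γ r, ζ r)) (𝓝 s) (𝓝 (γ s, ζ s)) :=
    (γ.continuous.tendsto s).prodMk_nhds (hζc.tendsto s)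
  filter_upwards [ht.eventually (hzu s), (γ.continuous.tendsto s).eventually (hz s).eventually]
    with r hr hroot
  exact .add .rfl ((hz r).eventuallyEq (h r).2 (h r).3 hroot ((hzζ r).trans (hr (hζ r)))
    (by rw [hzζ r]; exact hs r))

theorem IsCubicRootNear.exists_isContinuationAlong {z : ℂ × ℂ → ℂ}
    (hz : IsCubicRootNear p q z y₀) (h : ∀ s, HolomorphicTripleAt a p q (γ s))
    (hD : ∀ s, discr p q (γ s) ≠ 0) :
    ∃ f, IsContinuationAlong γ f ∧ f 0 =ᶠ[𝓝 y₀] fun w => a w + z w := by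
  have hp : Continuous fun s => p (γ s) := continuous_iff_continuousAt.2 fun s =>
    (h s).2.continuousAt.comp γ.continuous.continuousAt
  have hq : Continuous fun s => q (γ s) := continuous_iff_continuousAt.2 fun s =>
    (h s).3.continuousAt.comp γ.continuous.continuousAt
  obtain ⟨ζ, hζc, hζ0, hζ⟩ := exists_continuous_cubic_root hp hq hD (ζ₀ := z y₀)
    (by simpa using hz.self)
  obtain ⟨Z, hcont, hZ⟩ := exists_isContinuationAlong_of_roots h hD hζc hζ
  have hZ0 := hZ 0
  have h0 := h 0
  have hD0 := hD 0
  rw [γ.source] at hZ0 h0 hD0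
  exact ⟨_, hcont, .add .rfl (hZ0.1.eventuallyEq h0.2 h0.3 hz (hZ0.2.trans hζ0)
    (three_mul_sq_ne_of_discr_ne_zero hZ0.1.self hD0))⟩

theorem IsContinuationAlong.isCubicRootNear {f : unitInterval → ℂ × ℂ → ℂ}
    (hf : IsContinuationAlong γ f) (h : ∀ s, HolomorphicTripleAt a p q (γ s))
    (h₀ : IsCubicRootNear p q (fun w => f 0 w - a w) y₀) (s : unitInterval) :
    IsCubicRootNear p q (fun w => f s w - a w) (γ s) := by
  have han (s) : AnalyticAt ℂ (fun w => f s w - a w) (γ s) := (hf.1 s).sub (h s).1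
  set G : unitInterval → ℂ × ℂ → ℂ := fun s w =>
    (f s w - a w) ^ 3 - (p w * (f s w - a w) + q w) with hG
  have hGan (s) : AnalyticAt ℂ (G s) (γ s) :=
    ((han s).pow 3).sub (((h s).2.mul (han s)).add (h s).3)
  have hroot (s) : IsCubicRootNear p q (fun w => f s w - a w) (γ s) ↔ G s =ᶠ[𝓝 (γ s)] 0 :=
    ⟨fun hs => hs.2.mono fun _ => sub_eq_zero.2,
      fun hs => ⟨han s, hs.mono fun _ => sub_eq_zero.1⟩⟩
  have hlocal (s) : ∀ᶠ r in 𝓝 s, G r =ᶠ[𝓝 (γ r)] 0 ↔ G s =ᶠ[𝓝 (γ s)] 0 := by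
    filter_upwards [hf.2 s,
      (γ.continuous.tendsto s).eventually (eventually_eventuallyEq_zero_iff (hGan s))] with r hr hrs
    have hGr : G r =ᶠ[𝓝 (γ r)] G s := hr.mono fun w hw => by simp only [hG, hw]
    exact ⟨fun h => hrs.1 (hGr.symm.trans h), fun h => hGr.trans (hrs.2 h)⟩
  have hconst : IsLocallyConstant fun s => G s =ᶠ[𝓝 (γ s)] 0 :=
    IsLocallyConstant.iff_eventually_eq _ |>.2 fun s => (hlocal s).mono fun _ => propext
  rw [hroot, hconst.apply_eq_of_isPreconnected isPreconnected_univ (Set.mem_univ s)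
    (Set.mem_univ 0), ← hroot, γ.source]
  exact h₀

end Continuation

/-! ### Monodromy of the roots around the cusp -/

/-- The coefficients `(P, Q)` of the cubic `Z ^ 3 - P Z - Q` with roots `z₁`, `z₂`, `-z₁ - z₂`. -/
def cubicOfRoots (v : ℂ × ℂ) : ℂ × ℂ :=
  (v.1 ^ 2 + v.1 * v.2 + v.2 ^ 2, -(v.1 * v.2 * (v.1 + v.2)))

/-- The product of the differences of `z₁`, `z₂`, `-z₁ - z₂`, up to sign a square root of the
discriminant of `cubicOfRoots (z₁, z₂)`. -/
def rootDifferences (v : ℂ × ℂ) : ℂ := (v.1 - v.2) * (2 * v.1 + v.2) * (v.1 + 2 * v.2)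

theorem discr_cubicOfRoots (v : ℂ × ℂ) :
    4 * (cubicOfRoots v).1 ^ 3 - 27 * (cubicOfRoots v).2 ^ 2 = rootDifferences v ^ 2 := by
  simp only [cubicOfRoots, rootDifferences]
  ring

theorem root_cubicOfRoots (v : ℂ × ℂ) :
    v.1 ^ 3 = (cubicOfRoots v).1 * v.1 + (cubicOfRoots v).2 := by
  simp only [cubicOfRoots]
  ring

theorem cubicOfRoots_swap (v : ℂ × ℂ) : cubicOfRoots v.swap = cubicOfRoots v := by
  simp only [cubicOfRoots, Prod.fst_swap, Prod.snd_swap]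
  ext <;> ring

@[fun_prop]
theorem continuous_cubicOfRoots : Continuous cubicOfRoots := by
  unfold cubicOfRoots
  fun_prop

theorem exists_cubicOfRoots_eq {z : ℂ} {c : ℂ × ℂ} (h : z ^ 3 = c.1 * z + c.2) :
    ∃ z' : ℂ, cubicOfRoots (z, z') = c := by
  obtain ⟨s, hs⟩ := IsAlgClosed.exists_pow_nat_eq (4 * c.1 - 3 * z ^ 2) two_pos
  have hP : z ^ 2 + z * ((s - z) / 2) + ((s - z) / 2) ^ 2 = c.1 := by
    linear_combination hs / 4
  refine ⟨(s - z) / 2, Prod.ext hP ?_⟩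
  simp only [cubicOfRoots]
  linear_combination h - z * hP

theorem cubicOfRoots_smul (k : ℂ) (v : ℂ × ℂ) :
    cubicOfRoots (k • v) = (k ^ 2 * (cubicOfRoots v).1, k ^ 3 * (cubicOfRoots v).2) := by
  simp only [cubicOfRoots, Prod.smul_fst, Prod.smul_snd, smul_eq_mul]
  ext <;> ring

theorem rootDifferences_smul (k : ℂ) (v : ℂ × ℂ) :
    rootDifferences (k • v) = k ^ 3 * rootDifferences v := by
  simp only [rootDifferences, Prod.smul_fst, Prod.smul_snd, smul_eq_mul]
  ring

theorem norm_cubicOfRoots_smul_le {k : ℂ} (hk : ‖k‖ ≤ 1) (v : ℂ × ℂ) :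
    ‖cubicOfRoots (k • v)‖ ≤ ‖cubicOfRoots v‖ := by
  have hpow (n : ℕ) (x : ℂ) : ‖k ^ n * x‖ ≤ ‖x‖ := by
    rw [norm_mul, norm_pow]
    exact mul_le_of_le_one_left (norm_nonneg _) (pow_le_one₀ (norm_nonneg _) hk)
  rw [cubicOfRoots_smul]
  exact max_le_max (hpow 2 _) (hpow 3 _)

/-- The complex line through `A` and `B` meets the hyperplanes in countably many points, and the
complement of a countable set in `ℂ` is path connected. -/
theorem joinedIn_forall_apply_ne_zero {ι E : Type*} [Countable ι] [AddCommGroup E] [Module ℂ E]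
    [TopologicalSpace E] [ContinuousAdd E] [ContinuousSMul ℂ E] (ℓ : ι → E →ₗ[ℂ] ℂ) {A B : E}
    (hA : ∀ i, ℓ i A ≠ 0) (hB : ∀ i, ℓ i B ≠ 0) : JoinedIn {v | ∀ i, ℓ i v ≠ 0} A B := by
  have hsub (i) : {c : ℂ | ℓ i (A + c • (B - A)) = 0}.Subsingleton := by
    intro c hc d hd
    rw [Set.mem_ofPred_eq, map_add, map_smul, smul_eq_mul] at hc hd
    have hne : ℓ i (B - A) ≠ 0 := fun h => hA i (by simpa [h] using hc)
    exact mul_right_cancel₀ hne (by linear_combination hc - hd)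
  have hcount : (⋃ i, {c : ℂ | ℓ i (A + c • (B - A)) = 0}).Countable :=
    Set.countable_iUnion fun i => (hsub i).countable
  obtain ⟨η, hη⟩ := (hcount.isPathConnected_compl_of_one_lt_rank (by simp)).joinedIn
    0 (by simpa using hA) 1 (by simpa using hB)
  have hline : Continuous fun c : ℂ => A + c • (B - A) := by fun_prop
  exact ⟨(η.map hline).cast (by simp) (by simp), fun s i h =>
    hη s (Set.mem_iUnion.2 ⟨i, h⟩)⟩

theorem joinedIn_rootDifferences_ne_zero {A B : ℂ × ℂ} (hA : rootDifferences A ≠ 0)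
    (hB : rootDifferences B ≠ 0) : JoinedIn {v | rootDifferences v ≠ 0} A B := by
  let fst := LinearMap.fst ℂ ℂ ℂ
  let snd := LinearMap.snd ℂ ℂ ℂ
  let ℓ : Fin 3 → ℂ × ℂ →ₗ[ℂ] ℂ :=
    ![fst - snd, (2 : ℂ) • fst + snd, fst + (2 : ℂ) • snd]
  have hℓ (v : ℂ × ℂ) : rootDifferences v ≠ 0 ↔ ∀ i, ℓ i v ≠ 0 := by
    simp [Fin.forall_fin_succ, ℓ, fst, snd, rootDifferences, and_assoc]
  simp only [hℓ] at hA hB ⊢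
  exact joinedIn_forall_apply_ne_zero ℓ hA hB

/-- A path in `T` can be shrunk into `V` by a small factor; its ends are reached by shrinking `A`
and `B`. -/
theorem joinedIn_inter_of_smul_mem {E : Type*} [AddCommGroup E] [Module ℝ E] [TopologicalSpace E]
    [ContinuousAdd E] [ContinuousSMul ℝ E] {T V : Set E} {A B : E} (h : JoinedIn T A B)
    (hT : ∀ v ∈ T, ∀ k : ℝ, 0 < k → k ≤ 1 → k • v ∈ T) (hV : V ∈ 𝓝 0) (hstar : StarConvex ℝ 0 V)
    (hA : A ∈ V) (hB : B ∈ V) : JoinedIn (T ∩ V) A B := by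
  obtain ⟨η, hη⟩ := h
  obtain ⟨r, hrV, hr0, hr1⟩ : ∃ r : ℝ, (∀ s, r • η s ∈ V) ∧ 0 < r ∧ r < 1 := by
    have hsmall : ∀ᶠ r : ℝ in 𝓝 0, ∀ s ∈ (Set.univ : Set unitInterval), r • η s ∈ V := by
      refine isCompact_univ.eventually_forall_of_forall_eventually fun s _ => ?_
      have hc : Continuous fun x : ℝ × unitInterval => x.1 • η x.2 := by fun_prop
      exact hc.tendsto' (0, s) 0 (zero_smul ℝ _) hV
    obtain ⟨r, hr, hr01⟩ := ((hsmall.filter_mono nhdsWithin_le_nhds).and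
      (Ioo_mem_nhdsGT one_pos)).exists
    exact ⟨r, fun s => hr s trivial, hr01⟩
  have hshrink : ∀ C ∈ T ∩ V, JoinedIn (T ∩ V) C (r • C) := by
    rintro C ⟨hCT, hCV⟩
    refine JoinedIn.of_segment_subset ?_
    rintro _ ⟨α, β, hα, hβ, hαβ, rfl⟩
    rw [smul_smul, ← add_smul]
    have hpos : 0 < α + β * r := by nlinarith
    have hle : α + β * r ≤ 1 := by nlinarith
    exact ⟨hT C hCT _ hpos hle, starConvex_zero_iff.1 hstar hCV hpos.le hle⟩
  have hmid : JoinedIn (T ∩ V) (r • A) (r • B) :=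
    ⟨η.map (continuous_const_smul r), fun s => ⟨hT _ (hη s) r hr0 hr1.le, hrV s⟩⟩
  exact (hshrink A ⟨by simpa using hη 0, hA⟩).trans
    (hmid.trans (hshrink B ⟨by simpa using hη 1, hB⟩).symm)

theorem joinedIn_rootDifferences_ne_zero_inter_ball {ρ : ℝ} {A B : ℂ × ℂ}
    (hA : rootDifferences A ≠ 0) (hB : rootDifferences B ≠ 0)
    (hAρ : cubicOfRoots A ∈ Metric.ball 0 ρ) (hBρ : cubicOfRoots B ∈ Metric.ball 0 ρ) :
    JoinedIn ({v | rootDifferences v ≠ 0} ∩ cubicOfRoots ⁻¹' Metric.ball 0 ρ) A B := by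
  have hzero : cubicOfRoots 0 = 0 := by simp [cubicOfRoots]
  refine joinedIn_inter_of_smul_mem (joinedIn_rootDifferences_ne_zero hA hB)
    (fun v hv k hk _ => ?_) ?_ (starConvex_zero_iff.2 fun v hv k hk hk1 => ?_) hAρ hBρ
  · rw [Set.mem_ofPred_eq, ← Complex.coe_smul, rootDifferences_smul]
    exact mul_ne_zero (pow_ne_zero 3 (Complex.ofReal_ne_zero.2 hk.ne')) hv
  · refine continuous_cubicOfRoots.continuousAt.preimage_mem_nhds ?_
    rw [hzero]
    exact Metric.ball_mem_nhds 0 (Metric.pos_of_mem_ball hAρ)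
  · rw [Set.mem_preimage, mem_ball_zero_iff] at hv ⊢
    rw [← Complex.coe_smul]
    refine (norm_cubicOfRoots_smul_le ?_ v).trans_lt hv
    rwa [Complex.norm_real, Real.norm_of_nonneg hk]

theorem exists_multiple_root {P Q : ℂ} (h : 4 * P ^ 3 - 27 * Q ^ 2 = 0) :
    ∃ ζ : ℂ, P = 3 * ζ ^ 2 ∧ Q = -2 * ζ ^ 3 := by
  by_cases hP : P = 0
  · have hQ : Q = 0 := by simpa [hP] using h
    exact ⟨0, by simp [hP], by simp [hQ]⟩
  · have h1 : P = 3 * (-3 * Q / (2 * P)) ^ 2 := by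
      field_simp
      linear_combination h
    refine ⟨-3 * Q / (2 * P), h1, ?_⟩
    have h2 : (-3 * Q / (2 * P)) ^ 3 = -3 * Q / (2 * P) * (P / 3) := by
      linear_combination -(-3 * Q / (2 * P) / 3) * h1
    rw [h2]
    field_simp

theorem eventually_rootDifferences_add_sub_ne_zero (ζ : ℂ) :
    ∀ᶠ η in 𝓝[≠] 0, rootDifferences (ζ + η, ζ - η) ≠ 0 := by
  have hform (η : ℂ) : rootDifferences (ζ + η, ζ - η) = 2 * η * (9 * ζ ^ 2 - η ^ 2) := by
    simp only [rootDifferences]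
    ring
  have h9 : ∀ᶠ η in 𝓝[≠] (0 : ℂ), 9 * ζ ^ 2 - η ^ 2 ≠ 0 := by
    rcases eq_or_ne ζ 0 with rfl | hζ
    · filter_upwards [self_mem_nhdsWithin] with η hη
      simpa using hη
    · have hc : ContinuousAt (fun η : ℂ => 9 * ζ ^ 2 - η ^ 2) 0 := by fun_prop
      exact nhdsWithin_le_nhds (hc.eventually_ne (by simpa using hζ))
  filter_upwards [h9, self_mem_nhdsWithin] with η h9 hη
  rw [hform]
  exact mul_ne_zero (mul_ne_zero two_ne_zero hη) h9

/-- The two roots merging into the double root `ζ` are exchanged along a half circle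
`ζ ± η e ^ (i π s)`. -/
theorem exists_swap_path {c : ℂ × ℂ} (hc : 4 * c.1 ^ 3 - 27 * c.2 ^ 2 = 0) {V : Set (ℂ × ℂ)}
    (hV : V ∈ 𝓝 c) : ∃ (v : ℂ × ℂ) (τ : Path v v.swap),
      ∀ s, rootDifferences (τ s) ≠ 0 ∧ cubicOfRoots (τ s) ∈ V := by
  obtain ⟨ζ, hP, hQ⟩ := exists_multiple_root hc
  have hζ : cubicOfRoots (ζ + 0, ζ - 0) = c := by
    simp only [cubicOfRoots]
    ext
    · linear_combination -hP
    · linear_combination -hQ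
  have hcont : Continuous fun η : ℂ => cubicOfRoots (ζ + η, ζ - η) := by fun_prop
  have hgood : ∀ᶠ η in 𝓝[≠] (0 : ℂ),
      rootDifferences (ζ + η, ζ - η) ≠ 0 ∧ cubicOfRoots (ζ + η, ζ - η) ∈ V :=
    (eventually_rootDifferences_add_sub_ne_zero ζ).and
      (nhdsWithin_le_nhds (hcont.tendsto' 0 c hζ hV))
  obtain ⟨ε, hε, hball⟩ := Metric.eventually_nhds_iff_ball.1 (eventually_nhdsWithin_iff.1 hgood)
  set e : unitInterval → ℂ := fun s =>
    ((ε / 2 : ℝ) : ℂ) * Complex.exp (((s * Real.pi : ℝ) : ℂ) * Complex.I) with he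
  have hnorm (s) : ‖e s‖ = ε / 2 := by
    rw [he, norm_mul, Complex.norm_exp_ofReal_mul_I, mul_one, Complex.norm_real,
      Real.norm_of_nonneg (by positivity)]
  let τ : Path ((ζ + e 0, ζ - e 0) : ℂ × ℂ) (ζ - e 0, ζ + e 0) :=
    { toFun s := (ζ + e s, ζ - e s)
      continuous_toFun := by fun_prop
      source' := rfl
      target' := by simp [he, sub_eq_add_neg] }
  refine ⟨_, τ, fun s => hball (e s) ?_ (norm_pos_iff.1 (by rw [hnorm]; positivity))⟩
  rw [mem_ball_zero_iff, hnorm]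
  exact half_lt_self hε

section Chart

variable {a p q : ℂ × ℂ → ℂ} {φ : OpenPartialHomeomorph (ℂ × ℂ) (ℂ × ℂ)}

theorem exists_isContinuationAlong_of_path_roots (hφ : ⇑φ = fun w => (p w, q w))
    (h : ∀ w ∈ φ.source, HolomorphicTripleAt a p q w) {A B : ℂ × ℂ} (σ : Path A B)
    (hσ : ∀ s, rootDifferences (σ s) ≠ 0) (hσφ : ∀ s, cubicOfRoots (σ s) ∈ φ.target)
    {w₀ w₁ : ℂ × ℂ} (hw₀ : w₀ ∈ φ.source) (hw₁ : w₁ ∈ φ.source) (hA : φ w₀ = cubicOfRoots A)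
    (hB : φ w₁ = cubicOfRoots B) :
    ∃ (γ : Path w₀ w₁) (z : unitInterval → ℂ × ℂ → ℂ),
      (∀ s, γ s ∈ φ.source \ cusp φ.source p q) ∧ (∀ s, φ (γ s) = cubicOfRoots (σ s)) ∧
      IsContinuationAlong γ (fun s w => a w + z s w) ∧
      (IsCubicRootNear p q (z 0) w₀ ∧ z 0 w₀ = A.1) ∧
      (IsCubicRootNear p q (z 1) w₁ ∧ z 1 w₁ = B.1) := by
  let γ : Path w₀ w₁ :=
    { toFun s := φ.symm (cubicOfRoots (σ s))
      continuous_toFun := φ.continuousOn_symm.comp_continuous (by fun_prop) hσφ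
      source' := by rw [σ.source, ← hA, φ.left_inv hw₀]
      target' := by rw [σ.target, ← hB, φ.left_inv hw₁] }
  have hγs (s) : γ s ∈ φ.source := φ.map_target (hσφ s)
  have hγ (s) : φ (γ s) = cubicOfRoots (σ s) := φ.right_inv (hσφ s)
  have hpq (s) : p (γ s) = (cubicOfRoots (σ s)).1 ∧ q (γ s) = (cubicOfRoots (σ s)).2 := by
    rw [← hγ, hφ]
    exact ⟨rfl, rfl⟩
  have hD (s) : discr p q (γ s) ≠ 0 := by
    rw [discr, (hpq s).1, (hpq s).2, discr_cubicOfRoots]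
    exact pow_ne_zero 2 (hσ s)
  obtain ⟨z, hz, hzσ⟩ := exists_isContinuationAlong_of_roots (fun s => h _ (hγs s)) hD
    (ζ := fun s => (σ s).1) (by fun_prop)
    (fun s => by rw [(hpq s).1, (hpq s).2]; exact root_cubicOfRoots _)
  exact ⟨γ, z, fun s => ⟨hγs s, fun hs => hD s hs.2⟩, hγ, hz, by simpa using hzσ 0,
    by simpa using hzσ 1⟩

/-- In the chart `(p, q)` the branches become the roots of the universal cubic
`z ^ 3 = P z + Q`, and any root can be moved to one of the two roots exchanged near the given
point of the cusp. -/
theorem isRamifiedAround_cusp (hφ : ⇑φ = fun w => (p w, q w)) {ρ : ℝ}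
    (hρ : φ.target = Metric.ball 0 ρ) (h : ∀ w ∈ φ.source, HolomorphicTripleAt a p q w)
    {y₀ : ℂ × ℂ} (hy₀ : y₀ ∈ φ.source) (hD₀ : discr p q y₀ ≠ 0) {z : ℂ × ℂ → ℂ}
    (hz : IsCubicRootNear p q z y₀) :
    IsRamifiedAround φ.source (cusp φ.source p q) y₀ (fun w => a w + z w) := by
  refine ⟨fun y₁ γ hγ => hz.exists_isContinuationAlong (fun s => h _ (hγ s).1)
    fun s hs => (hγ s).2 ⟨(hγ s).1, hs⟩, fun y hy W hW => ?_⟩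
  have huniq {w z₁ z₂} (hw : w ∈ φ.source) (hD : discr p q w ≠ 0)
      (h₁ : IsCubicRootNear p q z₁ w ∧ z₁ w = z₂ w) (h₂ : IsCubicRootNear p q z₂ w) :
      (fun w => a w + z₁ w) =ᶠ[𝓝 w] fun w => a w + z₂ w :=
    .add .rfl (h₁.1.eventuallyEq (h w hw).2 (h w hw).3 h₂ h₁.2
      (three_mul_sq_ne_of_discr_ne_zero h₁.1.self hD))
  have hV : φ.target ∩ φ.symm ⁻¹' W ∈ 𝓝 (φ y) := inter_mem (φ.open_target.mem_nhds
    (φ.map_source hy.1)) ((φ.continuousAt_symm (φ.map_source hy.1)) (by rwa [φ.left_inv hy.1]))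
  obtain ⟨v, τ, hτ⟩ := exists_swap_path (c := φ y) (by rw [hφ]; exact hy.2) hV
  have hv : rootDifferences v ≠ 0 ∧ cubicOfRoots v ∈ φ.target ∩ φ.symm ⁻¹' W := by
    simpa using hτ 0
  obtain ⟨z', hz'⟩ := exists_cubicOfRoots_eq (c := φ y₀) (by rw [hφ]; exact hz.self)
  have hz'D : rootDifferences (z y₀, z') ≠ 0 := by
    rw [← pow_ne_zero_iff two_ne_zero, ← discr_cubicOfRoots, hz', hφ]
    exact hD₀
  have hz'ρ : cubicOfRoots (z y₀, z') ∈ φ.target := hz' ▸ φ.map_source hy₀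
  obtain ⟨σ, hσ⟩ := joinedIn_rootDifferences_ne_zero_inter_ball hz'D hv.1 (hρ ▸ hz'ρ)
    (hρ ▸ hv.2.1)
  have hw := φ.map_target hv.2.1
  have hφw := φ.right_inv hv.2.1
  obtain ⟨γ, f, hγ, -, hf, hf0, hf1⟩ := exists_isContinuationAlong_of_path_roots hφ h σ
    (fun s => (hσ s).1) (fun s => hρ ▸ (hσ s).2) hy₀ hw hz'.symm hφw
  obtain ⟨δ, g, hδ, hφδ, hg, hg0, hg1⟩ := exists_isContinuationAlong_of_path_roots hφ h τ
    (fun s => (hτ s).1) (fun s => (hτ s).2.1) hw hw hφw (hφw.trans (cubicOfRoots_swap v).symm)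
  refine ⟨_, γ, δ, _, _, hγ, fun s => ⟨?_, hδ s⟩, hf, huniq hy₀ hD₀ hf0 hz, hg,
    huniq hw ?_ ⟨hg0.1, hg0.2.trans hf1.2.symm⟩ hf1.1, fun heq => ?_⟩
  · rw [← φ.left_inv (hδ s).1, hφδ]
    exact (hτ s).2.2
  · simpa using fun hs => (hγ 1).2 ⟨(hγ 1).1, by simpa using hs⟩
  · have hswap := add_left_cancel heq.eq_of_nhds
    rw [hg1.2, hg0.2] at hswap
    exact hv.1 (by rw [rootDifferences, ← hswap]; simp)

end Chart

/-! ### The chart given by the coefficients -/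

section Chart

variable {a₀ : ℂ → ℂ} {a p q : ℂ × ℂ → ℂ}

theorem fderiv_apply_eq_timeDeriv_add_spaceDeriv (f : ℂ × ℂ → ℂ) (y v : ℂ × ℂ) :
    fderiv ℂ f y v = v.1 * timeDeriv f y + v.2 * spaceDeriv f y := by
  have hv : v = v.1 • ((1, 0) : ℂ × ℂ) + v.2 • ((0, 1) : ℂ × ℂ) := by ext <;> simp
  conv_lhs => rw [hv, map_add, map_smul, map_smul]
  rfl

theorem HasInitialValues.timeDeriv_p (hinit : HasInitialValues a₀ a p q 0)
    (hp : AnalyticAt ℂ p (0, 0)) (hq : AnalyticAt ℂ q (0, 0))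
    (hsys : CoeffSystemAt a p q (0, 0)) : timeDeriv p (0, 0) = 1 := by
  have h1 : coeffOne a p q (0, 0) = 0 := hsys.2.1
  rw [coeffOne, hinit.spaceDeriv_p hp, hinit.spaceDeriv_q hq, hinit.self_of_nhds.2.1] at h1
  linear_combination h1

theorem HasInitialValues.linearIndependent_fderiv (hinit : HasInitialValues a₀ a p q 0)
    (hp : AnalyticAt ℂ p (0, 0)) (hq : AnalyticAt ℂ q (0, 0))
    (hsys : CoeffSystemAt a p q (0, 0)) :
    LinearIndependent ℂ ![fderiv ℂ p (0, 0), fderiv ℂ q (0, 0)] := by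
  refine LinearIndependent.pair_iff.2 fun s t hst => ?_
  have happly (v : ℂ × ℂ) : s * fderiv ℂ p (0, 0) v + t * fderiv ℂ q (0, 0) v = 0 :=
    congrArg (fun L : ℂ × ℂ →L[ℂ] ℂ => L v) hst
  have htime := happly (1, 0)
  have hspace := happly (0, 1)
  simp only [fderiv_apply_eq_timeDeriv_add_spaceDeriv, hinit.spaceDeriv_p hp,
    hinit.spaceDeriv_q hq, hinit.timeDeriv_p hp hq hsys] at htime hspace
  have ht : t = 0 := by linear_combination hspace
  exact ⟨by linear_combination htime - timeDeriv q (0, 0) * ht, ht⟩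

theorem HolomorphicTripleAt.exists_chart (h : HolomorphicTripleAt a p q (0, 0))
    (hinit : HasInitialValues a₀ a p q 0) (hsys : CoeffSystemAt a p q (0, 0))
    {P : ℂ × ℂ → Prop} (hP : ∀ᶠ w in 𝓝 (0, 0), P w) :
    ∃ (φ : OpenPartialHomeomorph (ℂ × ℂ) (ℂ × ℂ)) (ρ : ℝ), ⇑φ = (fun w => (p w, q w)) ∧
      φ.target = Metric.ball 0 ρ ∧ HolomorphicNearOrigin φ.source a p q ∧
      ∀ w ∈ φ.source, P w := by
  obtain ⟨-, hp0, hq0⟩ := hinit.self_of_nhds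
  have hker (v : ℂ × ℂ) (hv : fderiv ℂ (fun w => (p w, q w)) (0, 0) v = 0) : v = 0 := by
    rw [h.2.differentiableAt.fderiv_prodMk h.3.differentiableAt] at hv
    have hpv : fderiv ℂ p (0, 0) v = 0 := congrArg Prod.fst hv
    have hqv : fderiv ℂ q (0, 0) v = 0 := congrArg Prod.snd hv
    rw [fderiv_apply_eq_timeDeriv_add_spaceDeriv, hinit.spaceDeriv_p h.2,
      hinit.timeDeriv_p h.2 h.3 hsys] at hpv
    have hv1 : v.1 = 0 := by linear_combination hpv
    rw [fderiv_apply_eq_timeDeriv_add_spaceDeriv, hinit.spaceDeriv_q h.3, hv1] at hqv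
    exact Prod.ext hv1 (by simpa using hqv)
  obtain ⟨φ, ρ, -, hφ, h0, htarget, hsource⟩ :=
    exists_openPartialHomeomorph_target_eq_ball (h.2.prod h.3) hker (h.eventually.and hP)
  have hconn : IsPreconnected φ.source := by
    rw [← φ.symm_image_target_eq_source]
    refine IsPreconnected.image ?_ _ φ.continuousOn_symm
    rw [htarget]
    exact (convex_ball _ _).isPreconnected
  exact ⟨φ, ρ, hφ, by rw [htarget, hp0, hq0, Prod.mk_zero_zero],
    ⟨φ.open_source, hconn, h0, fun w hw => (hsource w hw).1.1, fun w hw => (hsource w hw).1.2,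
      fun w hw => (hsource w hw).1.3⟩, fun w hw => (hsource w hw).2⟩

end Chart

theorem HasInitialValues.discr_ne_zero {a₀ : ℂ → ℂ} {a p q : ℂ × ℂ → ℂ} {x : ℂ}
    (h : HasInitialValues a₀ a p q x) (hx : x ≠ 0) : discr p q (0, x) ≠ 0 := by
  obtain ⟨-, hp, hq⟩ := h.self_of_nhds
  simpa [discr, hp, hq] using hx

theorem IsCubicRootNear.congr {p q z z' : ℂ × ℂ → ℂ} {y : ℂ × ℂ} (hz : IsCubicRootNear p q z y)
    (h : z =ᶠ[𝓝 y] z') : IsCubicRootNear p q z' y :=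
  ⟨hz.1.congr h, by filter_upwards [hz.2, h] with w hw e; rwa [← e]⟩

theorem IsContinuationAlong.solvesBurgersNear_and_isCubicRootNear {U : Set (ℂ × ℂ)}
    {a p q z : ℂ × ℂ → ℂ} (hU : HolomorphicNearOrigin U a p q)
    (hsol : ∀ y ∈ U, ∀ z, IsCubicRootNear p q z y → SolvesBurgersNear (fun w => a w + z w) y)
    {y₀ y₁ : ℂ × ℂ} {γ : Path y₀ y₁} {f : unitInterval → ℂ × ℂ → ℂ}
    (hf : IsContinuationAlong γ f) (hγ : ∀ s, γ s ∈ U) (hz : IsCubicRootNear p q z y₀)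
    (hf0 : f 0 =ᶠ[𝓝 y₀] fun w => a w + z w) (s : unitInterval) :
    SolvesBurgersNear (f s) (γ s) ∧ IsCubicRootNear p q (fun w => f s w - a w) (γ s) := by
  have hroot := hf.isCubicRootNear (fun s => hU.holomorphicTripleAt (hγ s))
    (hz.congr (hf0.mono fun w hw => by simp only [hw, add_sub_cancel_left])) s
  exact ⟨by simpa using hsol _ (hγ s) _ hroot, hroot⟩

end RamifiedBurgers

open RamifiedBurgers in
theorem mainTheorem1 (a₀ : ℂ → ℂ) (ha₀ : AnalyticAt ℂ a₀ 0) :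
    ∃ (U : Set (ℂ × ℂ)) (a p q : ℂ × ℂ → ℂ),
      HolomorphicNearOrigin U a p q ∧
      -- initial conditions
      (∀ x : ℂ, (0, x) ∈ U → a (0, x) = a₀ x ∧ p (0, x) = 0 ∧ q (0, x) = x) ∧
      -- every holomorphic branch of `a + z` solves the equation
      (∀ y ∈ U, ∀ z, IsCubicRootNear p q z y → SolvesBurgersNear (fun w => a w + z w) y) ∧
      -- for every branch of the datum, `a + z` is the unique solution germ, and it is
      -- ramified around the cusp; all its continuations are solutions of the same form
      (∀ x₀ : ℂ, x₀ ≠ 0 → (0, x₀) ∈ U → ∀ ω, IsCubeRootGerm ω x₀ →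
        ∃ z, IsCubicRootNear p q z (0, x₀) ∧
          SolvesIVP a₀ ω x₀ (fun w => a w + z w) ∧
          (∀ v, SolvesIVP a₀ ω x₀ v → v =ᶠ[𝓝 (0, x₀)] fun w => a w + z w) ∧
          IsRamifiedAround U (cusp U p q) (0, x₀) (fun w => a w + z w) ∧
          (∀ (y₁ : ℂ × ℂ) (γ : Path ((0 : ℂ), x₀) y₁) (f : unitInterval → ℂ × ℂ → ℂ),
            (∀ s, γ s ∈ U \ cusp U p q) → IsContinuationAlong γ f →
            (f 0 =ᶠ[𝓝 (0, x₀)] fun w => a w + z w) →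
            ∀ s, SolvesBurgersNear (f s) (γ s) ∧
              IsCubicRootNear p q (fun w => f s w - a w) (γ s))) ∧
      -- the singular locus is a genuine cusp with edge at the origin, and is characteristic
      (p (0, 0) = 0 ∧ q (0, 0) = 0 ∧
        LinearIndependent ℂ ![fderiv ℂ p (0, 0), fderiv ℂ q (0, 0)]) ∧
      CuspIsCharacteristic U a p q ∧
      -- uniqueness of the germs `a`, `p`, `q`
      (∀ (U' : Set (ℂ × ℂ)) (a' p' q' : ℂ × ℂ → ℂ),
        HolomorphicNearOrigin U' a' p' q' →
        (∀ᶠ x in 𝓝 (0 : ℂ), a' (0, x) = a₀ x ∧ p' (0, x) = 0 ∧ q' (0, x) = x) →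
        (∃ y ∈ U', ∃ z', IsCubicRootNear p' q' z' y ∧
          SolvesBurgersNear (fun w => a' w + z' w) y) →
        a' =ᶠ[𝓝 (0, 0)] a ∧ p' =ᶠ[𝓝 (0, 0)] p ∧ q' =ᶠ[𝓝 (0, 0)] q) := by
  obtain ⟨a, p, q, h, hinit, hsol⟩ := exists_cubicFamily ha₀
  have hsys := h.eventually_coeffSystemAt hinit hsol
  have hinit' : ∀ᶠ w in 𝓝 ((0, 0) : ℂ × ℂ), HasInitialValues a₀ a p q w.2 :=
    continuousAt_snd.eventually hinit.eventually
  obtain ⟨φ, ρ, hφ, hρ, hU, hP⟩ := h.exists_chart hinit hsys.self_of_nhds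
    (hinit'.and (hsol.and hsys))
  have hsolU : ∀ y ∈ φ.source, ∀ z, IsCubicRootNear p q z y →
      SolvesBurgersNear (fun w => a w + z w) y := fun y hy => (hP y hy).2.1
  refine ⟨φ.source, a, p, q, hU, fun x hx => (hP _ hx).1.self_of_nhds, hsolU,
    fun x₀ hx₀ hx₀U ω hω => ?_, ⟨hinit.self_of_nhds.2.1, hinit.self_of_nhds.2.2,
      hinit.linearIndependent_fderiv h.2 h.3 hsys.self_of_nhds⟩,
    cuspIsCharacteristic_of_coeffSystemAt hU.analytic_p hU.analytic_q fun w hw => (hP w hw).2.2,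
    fun U' a' p' q' hU' hinit₁ ⟨y, hy, z', hz', hu'⟩ => ?_⟩
  · have hinit₀ : HasInitialValues a₀ a p q x₀ := (hP _ hx₀U).1
    obtain ⟨z, hz, -, hu⟩ := (hU.holomorphicTripleAt hx₀U).exists_solvesIVP hinit₀
      (eventually_of_mem (hU.isOpen.mem_nhds hx₀U) fun w hw => (hP w hw).2.2) hx₀ hω
    exact ⟨z, hz, hu, fun v hv => hv.eventuallyEq hu,
      isRamifiedAround_cusp hφ hρ (fun w hw => hU.holomorphicTripleAt hw) hx₀U
        (hinit₀.discr_ne_zero hx₀) hz,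
      fun y₁ γ f hγ hf hf0 => hf.solvesBurgersNear_and_isCubicRootNear hU hsolU
        (fun s => (hγ s).1) hz hf0⟩
  · exact h.eventuallyEq (hU'.holomorphicTripleAt hU'.zero_mem) hinit hinit₁ hsys
      (hU'.eventually_coeffSystemAt_of_exists_branch hinit₁ hy hz' hu')
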